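/- Conventions. A word function $h:\mathbb N^*\to\mathbb N^*$ that is computable and monotone for the prefix order defines a partial function $F:\subseteq\mathbb N^{\mathbb N}\to\mathbb N^{\mathbb N}$, $F(p)=\sup_k h(p_0\dots p_{k-1})$, with $\operatorname{dom}F$ the set of $p$ for which this supremum is infinite; these $F$ are the computable ones. For partial maps $\delta:\subseteq\mathbb N^{\mathbb N}\to A$ and $\delta':\subseteq\mathbb N^{\mathbb N}\to B$ (representations; $p$ is a $\delta$-name of $\delta(p)$), a multi-valued operation $f:\subseteq A\rightrightarrows B$ with specified domain is $(\delta,\delta')$-computable if some computable $F$ maps every $\delta$-name of every $x\in\operatorname{dom} f$ to a $\delta'$-name of some element of $f(x)$. Write $\langle p^{(0)},p^{(1)},\dots\rangle(\langle i,j\rangle)=p^{(i)}_j$ with a standard pairing $\langle\cdot,\cdot\rangle$ of $\mathbb N$, and put $\delta^{\omega}\langle p^{(0)},p^{(1)},\dots\rangle=(\delta(p^{(i)}))_{i\in\mathbb N}$ and $\delta^{*}(n.\langle p^{(0)},p^{(1)},\dots\rangle)=(\delta(p^{(i)}))_{i<n}$; $[\delta,\delta']$ denotes the product representation, $\delta_{\mathbb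 N^*}(p)$ is the word with number $p_0$ in a standard numbering of $\mathbb N^*$. A computable metric space $(X,d,\nu)$ is a metric space $(X,d)$ with a dense sequence $\nu:\mathbb N\to X$ such that $(i,j)\mapsto d(\nu(i),\nu(j))$ is a computable double sequence of reals. Let $\alpha\langle a,r\rangle$ be the open ball with centre $\nu(a)$ and radius the $r$-th positive rational. The hyperspaces $\Sigma^0_1(X)$ of open sets and $\Pi^0_1(X)$ of closed sets are represented by $$\delta_{\Sigma^0_1}(p)=\bigcup\{\alpha(p_i-1): i\in\mathbb N,\ p_i\ge 1\},\qquad \delta_{\Pi^0_1}(p)=X\setminus\delta_{\Sigma^0_1}(p).$$ The order of a family $(A_i)_{i\in I}$ is the least $n$ such that $\bigcap_{j\le n}A_{i_j}=\emptyset$ for all distinct $i_0,\dots,i_n\in I$ (infinite if there is none). A shrinking of a cover $(U_i)_{i\in I}$ of $X$ is a cover $(W_i)_{i\in I}$ of $X$ with $W_i\subseteq U_i$ for all $i$. Fix $N\in\mathbb N$. The following operations have as domain all finite (for $C^*,\dot C^*,\overline C,\dot{\overline C}$) resp. all countable (for $C^\omega,\dot C^\omega$) indexed open covers of $X$: - $C^{*}((U_i)_{i<k})$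 is the set of open shrinkings $(W_i)_{i<k}$ of $(U_i)_{i<k}$ of order $\le N+1$; - $\dot C^{*}((U_i)_{i<k})$ is the set of pairs $((W_j)_{j<l},r)$ where $(W_j)_{j<l}$ is a finite open cover of $X$ of order $\le N+1$, $r\in\{0,\dots,k-1\}^{l}$, and $W_j\subseteq U_{r_j}$ for all $j<l$; - $\overline C$ and $\dot{\overline C}$ are defined in the same way as $C^{*}$ and $\dot C^{*}$, with closed sets $W_i$ resp. $W_j$ in place of open ones; - $C^{\omega}((U_i)_{i\in\mathbb N})$ is the set of open shrinkings $(W_i)_{i\in\mathbb N}$ of order $\le N+1$; - $\dot C^{\omega}((U_i)_{i\in\mathbb N})$ is the set of pairs $((W_j)_{j\in\mathbb N},r)$ where $(W_j)_{j\in\mathbb N}$ is an open cover of $X$ of order $\le N+1$, $r\in\mathbb N^{\mathbb N}$, and $W_j\subseteq U_{r_j}$ for all $j$. **Lemma.** Let $(X,d,\nu)$ be a computable metric space and $N\in\mathbb N$. Consider the conditions: 1. $C^{\omega}$ is $(\delta_{\Sigma^0_1}^{\omega},\delta_{\Sigma^0_1}^{\omega})$-computable; 2. $\dot C^{\omega}$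 is $(\delta_{\Sigma^0_1}^{\omega},[\delta_{\Sigma^0_1}^{\omega},\mathrm{id}_{\mathbb N^{\mathbb N}}])$-computable; 3. $C^{*}$ is $(\delta_{\Sigma^0_1}^{*},\delta_{\Sigma^0_1}^{*})$-computable; 4. $\dot C^{*}$ is $(\delta_{\Sigma^0_1}^{*},[\delta_{\Sigma^0_1}^{*},\delta_{\mathbb N^*}])$-computable; 5. $\overline C$ is $(\delta_{\Sigma^0_1}^{*},\delta_{\Pi^0_1}^{*})$-computable; 6. $\dot{\overline C}$ is $(\delta_{\Sigma^0_1}^{*},[\delta_{\Pi^0_1}^{*},\delta_{\mathbb N^*}])$-computable. Then 3, 4, 5 and 6 are equivalent; moreover 1 and 2 are equivalent, and 2 implies 3. -/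

import Mathlib

open TopologicalSpace Set

namespace EffDim

/-! ### Computability on Baire space and on represented sets -/

/-- Baire space `ℕ^ℕ`. -/
abbrev Baire : Type := ℕ → ℕ

/-- The finite prefix `p 0, …, p (k - 1)` of `p`. -/
def Baire.restrict (p : Baire) (k : ℕ) : List ℕ := (List.range k).map p

/-- Type-2 computability of a partial function `F : ⊆ ℕ^ℕ → ℕ^ℕ`: there is a computable word function
`h`, monotone for the prefix order, such that `F p` is the supremum of the words `h (p₀ … p_{k-1})`,
with `p ∈ dom F` exactly when this supremum is an infinite sequence. -/
def IsComputableBaire (F : Baire →. Baire) : Prop :=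
  ∃ h : List ℕ → List ℕ, Computable h ∧ (∀ u v, u <+: v → h u <+: h v) ∧
    ∀ p q : Baire, q ∈ F p ↔ ∀ n, ∃ k, q.restrict n <+: h (p.restrict k)

/-- The map `ℕ^ℕ → X` underlying a representation of `X`; `x ∈ δ p` says that `p` is a name
of `x`. -/
abbrev Rep (X : Type*) : Type _ := Baire →. X

/-- A partial multi-valued operation `f : ⊆ X ⇉ Y`. The domain is part of the data: a point of the
domain may have an empty set of values, and then `f` has no realiser. -/
structure MultiOp (X Y : Type*) where
  dom : Set X
  val : X → Set Y

/-- `F` is a `(δ, δ')`-realiser of `f`: it maps every name of every `x ∈ dom f` to a name of some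
element of `f x`. -/
def IsRealiser {X Y : Type*} (δ : Rep X) (δ' : Rep Y) (f : MultiOp X Y) (F : Baire →. Baire) : Prop :=
  ∀ p x, x ∈ δ p → x ∈ f.dom → ∃ q ∈ F p, ∃ y ∈ δ' q, y ∈ f.val x

/-- `f` is `(δ, δ')`-computable. -/
def IsComputableOp {X Y : Type*} (δ : Rep X) (δ' : Rep Y) (f : MultiOp X Y) : Prop :=
  ∃ F : Baire →. Baire, IsComputableBaire F ∧ IsRealiser δ δ' f F

/-- The `i`-th component `p⁽ⁱ⁾` of `p = ⟨p⁽⁰⁾, p⁽¹⁾, …⟩`, where `p ⟨i, j⟩ = p⁽ⁱ⁾ j`. -/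
def Baire.component (p : Baire) (i : ℕ) : Baire := fun j => p (Nat.pair i j)

/-- The representation `δ^ω` of sequences: `⟨p⁽⁰⁾, p⁽¹⁾, …⟩ ↦ (δ p⁽⁰⁾, δ p⁽¹⁾, …)`. -/
def Rep.seq {X : Type*} (δ : Rep X) : Rep (ℕ → X) := fun p =>
  ⟨∀ i, (δ (p.component i)).Dom, fun h i => (δ (p.component i)).get (h i)⟩

/-- The representation `δ^*` of finite words:
`n.⟨p⁽⁰⁾, p⁽¹⁾, …⟩ ↦ δ(p⁽⁰⁾) … δ(p⁽ⁿ⁻¹⁾)`. -/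
def Rep.word {X : Type*} (δ : Rep X) : Rep (List X) := fun p =>
  let t : Baire := fun m => p (m + 1)
  ⟨∀ i : Fin (p 0), (δ (t.component i)).Dom,
    fun h => List.ofFn fun i : Fin (p 0) => (δ (t.component i)).get (h i)⟩

/-- The representation `[δ₁, δ₂]` of pairs, with `⟨p⁽⁰⁾, p⁽¹⁾⟩ (2 i + z) = p⁽ᶻ⁾ i`. -/
def Rep.prod {X Y : Type*} (δ₁ : Rep X) (δ₂ : Rep Y) : Rep (X × Y) := fun p =>
  let p₀ : Baire := fun i => p (2 * i)
  let p₁ : Baire := fun i => p (2 * i + 1)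
  ⟨(δ₁ p₀).Dom ∧ (δ₂ p₁).Dom, fun h => ((δ₁ p₀).get h.1, (δ₂ p₁).get h.2)⟩

/-- The identity representation of Baire space. -/
def repBaire : Rep Baire := fun p => Part.some p

/-- The representation of `ℕ^*` given by a standard bijective numbering of `ℕ^*`: the first entry of
a name is the number of the word. -/
def repNatWord : Rep (List ℕ) := fun p => Part.some (Denumerable.ofNat (List ℕ) (p 0))

/-! ### Computable metric spaces and their hyperspaces -/

/-- `(X, d, ν)` is a computable metric space: `ν` is a dense sequence and the double sequence of
reals `d (ν i) (ν j)` is computable, that is, a computable function of `(i, j, k)` yields the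
numerator and (one less than) the denominator of a rational with error less than `2⁻ᵏ`. -/
structure IsComputableMetricSpace {X : Type*} [MetricSpace X] (ν : ℕ → X) : Prop where
  dense : DenseRange ν
  dist_computable : ∃ f : ℕ × ℕ × ℕ → ℕ × ℕ, Computable f ∧ ∀ i j k : ℕ,
    |dist (ν i) (ν j) - ((f (i, j, k)).1 : ℝ) / (((f (i, j, k)).2 : ℝ) + 1)| < (1 / 2 : ℝ) ^ k

/-- A standard total numbering of the positive rationals: `⟨a, b⟩ ↦ (a + 1) / (b + 1)`. -/
def posRat (n : ℕ) : ℚ := ((n.unpair.1 : ℚ) + 1) / ((n.unpair.2 : ℚ) + 1)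

section Hyperspaces

variable {X : Type*} [MetricSpace X]

/-- The numbering `⟨a, r⟩ ↦ B(ν(a), r)` of the ideal open balls. -/
def idealBall (ν : ℕ → X) (n : ℕ) : Set X :=
  Metric.ball (ν n.unpair.1) (posRat n.unpair.2 : ℝ)

/-- The open set `⋃ {α(p i - 1) ∣ p i ≥ 1}` named by `p`, where `α` numbers the ideal balls. -/
def openOf (ν : ℕ → X) (p : Baire) : Opens X :=
  ⟨⋃ (i : ℕ) (_ : 1 ≤ p i), idealBall ν (p i - 1),
    isOpen_iUnion fun _ => isOpen_iUnion fun _ => Metric.isOpen_ball⟩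

/-- The (total) representation of the hyperspace `Σ⁰₁(X)` of open subsets. -/
def repOpen (ν : ℕ → X) : Rep (Opens X) := fun p => Part.some (openOf ν p)

/-- The (total) representation of the hyperspace `Π⁰₁(X)` of closed subsets, by names of the
complements. -/
def repClosed (ν : ℕ → X) : Rep (Closeds X) := fun p => Part.some (openOf ν p).compl

end Hyperspaces

/-! ### Covers and their order -/

/-- The family `A` covers `X`. -/
def IsCover {X ι : Type*} (A : ι → Set X) : Prop := ⋃ i, A i = univ

/-- The order of an indexed family: the least `n` such that `⋂_{j ≤ n} A (i_j)` is empty for all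
distinct indices `i_0, …, i_n`; it is `⊤` if there is no such `n`. -/
noncomputable def famOrder {X ι : Type*} (A : ι → Set X) : ℕ∞ :=
  ⨅ (n : ℕ) (_ : ∀ i : Fin (n + 1) → ι, Function.Injective i → ⋂ j, A (i j) = ∅), (n : ℕ∞)

/-- The family of subsets of `X` given by a finite word of (open or closed) sets. -/
def wordFam {X S : Type*} [SetLike S X] (W : List S) : Fin W.length → Set X :=
  fun i => (W.get i : Set X)

/-- The family of subsets of `X` given by a sequence of (open or closed) sets. -/
def seqFam {X S : Type*} [SetLike S X] (W : ℕ → S) : ℕ → Set X := fun i => (W i : Set X)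

/-! ### The operations
In the operations on words, `S` is `Opens X` or `Closeds X`. -/

section Operations

variable {X : Type*} [TopologicalSpace X]

/-- Finite open covers `(U_i)_{i<k}` are mapped to their shrinkings `(W_i)_{i<k}` of order
at most `N + 1` by members of `S`. -/
def finShrink (S : Type*) [SetLike S X] (N : ℕ) : MultiOp (List (Opens X)) (List S) where
  dom := {U | IsCover (wordFam U)}
  val U := {W | W.length = U.length ∧
    (∀ (i : ℕ) (hW : i < W.length) (hU : i < U.length), (W[i] : Set X) ⊆ (U[i] : Set X)) ∧
    IsCover (wordFam W) ∧ famOrder (wordFam W) ≤ (N : ℕ∞) + 1}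

/-- Finite open covers `(U_i)_{i<k}` are mapped to the pairs of a finite cover `(W_j)_{j<l}` by
members of `S` of order at most `N + 1` and a word `r` of length `l` in the indices `0, …, k - 1`,
with `W_j ⊆ U_{r_j}` for all `j < l`. -/
def finRefine (S : Type*) [SetLike S X] (N : ℕ) :
    MultiOp (List (Opens X)) (List S × List ℕ) where
  dom := {U | IsCover (wordFam U)}
  val U := {Wr | Wr.2.length = Wr.1.length ∧
    (∀ (j : ℕ) (hW : j < Wr.1.length) (hr : j < Wr.2.length),
      ∃ hU : Wr.2[j] < U.length, (Wr.1[j] : Set X) ⊆ (U[Wr.2[j]] : Set X)) ∧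
    IsCover (wordFam Wr.1) ∧ famOrder (wordFam Wr.1) ≤ (N : ℕ∞) + 1}

/-- Countable open covers `(U_i)_{i∈ℕ}` are mapped to their open shrinkings of order
at most `N + 1`. -/
def seqShrink (X : Type*) [TopologicalSpace X] (N : ℕ) : MultiOp (ℕ → Opens X) (ℕ → Opens X) where
  dom := {U | IsCover (seqFam U)}
  val U := {W | (∀ i, (W i : Set X) ⊆ (U i : Set X)) ∧
    IsCover (seqFam W) ∧ famOrder (seqFam W) ≤ (N : ℕ∞) + 1}

/-- Countable open covers `(U_i)_{i∈ℕ}` are mapped to the pairs of a countable open cover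
`(W_j)_{j∈ℕ}` of order at most `N + 1` and `r ∈ ℕ^ℕ` with `W_j ⊆ U_{r_j}` for all `j`. -/
def seqRefine (X : Type*) [TopologicalSpace X] (N : ℕ) :
    MultiOp (ℕ → Opens X) ((ℕ → Opens X) × Baire) where
  dom := {U | IsCover (seqFam U)}
  val U := {Wr | (∀ j, (Wr.1 j : Set X) ⊆ (U (Wr.2 j) : Set X)) ∧
    IsCover (seqFam Wr.1) ∧ famOrder (seqFam Wr.1) ≤ (N : ℕ∞) + 1}

end Operations

end EffDim

namespace EffDim

/-! ### Closure properties of computable functions and predicates -/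

section Computability

variable {α σ : Type*} [Primcodable α] [Primcodable σ]

/-! For finite covers the four conditions form a cycle: open shrinkings give closed shrinkings,
these give closed refinements, these give open refinements, and these give open shrinkings again.
Two of the steps are formal. A shrinking is a refinement with the identity as index map, and a
refinement becomes a shrinking after uniting all members with the same index, which cannot raise the
order (`OrderLE.of_map`). The same two remarks settle countable covers. A finite cover is treated as
a countable one by appending empty sets, whose shrinkings are empty.

The substance lies in passing between open and closed sets, and one construction serves both
directions. Given names of open sets O_0, ..., O_{k-1} and a threshold t, enumerate into S_i every
ball that at some stage n is seen to lie in at least t of the O_j and to avoid the part of O_i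
enumerated so far, shrunk by 2^(-n) (`Swell`). Then S_i contains every point outside O_i that lies
in at least t of the O_j (`eventually_swell`), and a point lying in S_i for all i in a nonempty I
forces |I| + t ≤ k (`card_add_le_of_swell`).

For an open cover take t = 1. The complements of the S_i are then closed subsets of the O_i, and
they cover because no point lies in all k of the S_i. For a closed cover of order at most N + 1, let
O_i be the complements and t = k - (N + 1). Every point lies in at least t of the O_j, so S_i is a
neighbourhood of the i-th closed set, and the S_i again have order at most N + 1. Intersecting S_i
with the prescribed member of the original cover makes it a refinement.

The stage-wise tests are decidable and read only finitely much of the names, so the constructions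
act on names as functionals with a fixed modulus. `IsComputableOp.transfer` turns each of them into
a reduction between operations. -/

theorem computable_map_range {n : α → ℕ} {f : α → ℕ → σ} (hn : Computable n)
    (hf : Computable₂ f) : Computable fun a => (List.range (n a)).map (f a) := by
  have h := Computable.nat_rec (h := fun a (x : ℕ × List σ) => x.2 ++ [f a x.1]) hn
    (Computable.const ([] : List σ))
    (Computable.list_concat.comp (Computable.snd.comp Computable.snd)
      (hf.comp Computable.fst (Computable.fst.comp Computable.snd))).to₂
  refine h.of_eq fun a => ?_
  induction n a with
  | zero => rfl
  | succ k ih => simp only [ih, List.range_succ, List.map_append, List.map_cons, List.map_nil]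

theorem computablePred_of_decide {p : α → Prop} {f : α → Bool} (hf : Computable f)
    (h : ∀ a, f a = true ↔ p a) : ComputablePred p :=
  ComputablePred.computable_iff.2 ⟨f, hf, funext fun a => propext (h a).symm⟩

theorem computablePred_and {p q : α → Prop} (hp : ComputablePred p) (hq : ComputablePred q) :
    ComputablePred fun a => p a ∧ q a := by
  obtain ⟨f, hf, rfl⟩ := ComputablePred.computable_iff.1 hp
  obtain ⟨g, hg, rfl⟩ := ComputablePred.computable_iff.1 hq
  exact computablePred_of_decide (Primrec.and.to_comp.comp hf hg) fun a => by simp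

theorem computablePred_exists_lt {n : α → ℕ} {p : α → ℕ → Prop} (hn : Computable n)
    (hp : ComputablePred fun x : α × ℕ => p x.1 x.2) :
    ComputablePred fun a => ∃ c < n a, p a c := by
  obtain ⟨f, hf, hpf⟩ := ComputablePred.computable_iff.1 hp
  have hpf' : ∀ a c, p a c ↔ f (a, c) = true := fun a c => iff_of_eq (congrFun hpf (a, c))
  refine computablePred_of_decide (Computable.nat_rec
    (h := fun a (x : ℕ × Bool) => x.2 || f (a, x.1)) hn (Computable.const false)
    (Primrec.or.to_comp.comp (Computable.snd.comp Computable.snd)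
      (hf.comp (Computable.fst.pair (Computable.fst.comp Computable.snd)))).to₂) fun a => ?_
  induction n a with
  | zero => simp
  | succ k ih =>
    simp only [Bool.or_eq_true, ih, ← hpf', Nat.lt_succ_iff_lt_or_eq]
    constructor
    · rintro (⟨c, hc, h⟩ | h)
      exacts [⟨c, .inl hc, h⟩, ⟨k, .inr rfl, h⟩]
    · rintro ⟨c, hc | rfl, h⟩
      exacts [.inl ⟨c, hc, h⟩, .inr h]

theorem computablePred_forall_lt {n : α → ℕ} {p : α → ℕ → Prop} (hn : Computable n)
    (hp : ComputablePred fun x : α × ℕ => p x.1 x.2) :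
    ComputablePred fun a => ∀ c < n a, p a c :=
  (computablePred_exists_lt (p := fun a c => ¬ p a c) hn hp.not).not.of_eq fun a => by simp

theorem computablePred_imp {p q : α → Prop} (hp : ComputablePred p) (hq : ComputablePred q) :
    ComputablePred fun a => p a → q a :=
  (computablePred_and hp hq.not).not.of_eq fun a => by tauto

open Classical in
theorem computable_count {n : α → ℕ} {p : α → ℕ → Prop} (hn : Computable n)
    (hp : ComputablePred fun x : α × ℕ => p x.1 x.2) :
    Computable fun a => Nat.count (p a) (n a) := by
  obtain ⟨f, hf, hpf⟩ := ComputablePred.computable_iff.1 hp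
  have hpf' : ∀ a c, p a c ↔ f (a, c) = true := fun a c => iff_of_eq (congrFun hpf (a, c))
  have h := Computable.nat_rec
    (h := fun a (x : ℕ × ℕ) => bif f (a, x.1) then x.2 + 1 else x.2) hn (Computable.const 0)
    (Computable.cond (hf.comp (Computable.fst.pair (Computable.fst.comp Computable.snd)))
      (Computable.succ.comp (Computable.snd.comp Computable.snd))
      (Computable.snd.comp Computable.snd)).to₂
  refine h.of_eq fun a => ?_
  induction n a with
  | zero => simp
  | succ k ih =>
    simp only [ih, Nat.count_succ, hpf']
    cases f (a, k) <;> simp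

theorem computable_ite {p : α → Prop} [DecidablePred p] {f g : α → σ} (hp : ComputablePred p)
    (hf : Computable f) (hg : Computable g) : Computable fun a => if p a then f a else g a := by
  simpa [Bool.cond_decide] using Computable.cond hp.decide hf hg

theorem computablePred_eq {f g : α → σ} (hf : Computable f) (hg : Computable g) :
    ComputablePred fun a => f a = g a := by
  classical
  exact computablePred_of_decide ((Primrec.eq (α := σ)).decide.to_comp.comp hf hg) fun a => by simp

theorem computablePred_le {f g : α → ℕ} (hf : Computable f) (hg : Computable g) :
    ComputablePred fun a => f a ≤ g a :=
  computablePred_of_decide (Primrec.nat_le.decide.to_comp.comp hf hg) fun a => by simp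

theorem computable_add {f g : α → ℕ} (hf : Computable f) (hg : Computable g) :
    Computable fun a => f a + g a := Primrec.nat_add.to_comp.comp hf hg

theorem computable_sub {f g : α → ℕ} (hf : Computable f) (hg : Computable g) :
    Computable fun a => f a - g a := Primrec.nat_sub.to_comp.comp hf hg

theorem computable_mul {f g : α → ℕ} (hf : Computable f) (hg : Computable g) :
    Computable fun a => f a * g a := Primrec.nat_mul.to_comp.comp hf hg

theorem computable_pow {f g : α → ℕ} (hf : Computable f) (hg : Computable g) :
    Computable fun a => f a ^ g a :=
  (Primrec₂.unpaired'.1 Nat.Primrec.pow).to_comp.comp hf hg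

theorem computable_div_two {f : α → ℕ} (hf : Computable f) : Computable fun a => f a / 2 :=
  (Computable.nat_div2.comp hf).of_eq fun _ => Nat.div2_val _

theorem computable_unpair_fst {f : α → ℕ} (hf : Computable f) :
    Computable fun a => (f a).unpair.1 := Computable.fst.comp (Computable.unpair.comp hf)

theorem computable_unpair_snd {f : α → ℕ} (hf : Computable f) :
    Computable fun a => (f a).unpair.2 := Computable.snd.comp (Computable.unpair.comp hf)

theorem computable_getD {f : α → List ℕ} {g : α → ℕ} (hf : Computable f) (hg : Computable g) :
    Computable fun a => (f a).getD (g a) 0 := (Primrec.list_getD 0).to_comp.comp hf hg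

end Computability

/-! ### Transferring realisers along functionals with a computable modulus -/

theorem Baire.length_restrict (p : Baire) (k : ℕ) : (p.restrict k).length = k := by
  simp [Baire.restrict]

theorem Baire.getD_restrict (p : Baire) {k c : ℕ} (h : c < k) : (p.restrict k).getD c 0 = p c := by
  simp [Baire.restrict, List.getD_eq_getElem?_getD, h]

theorem getD_of_prefix {u v : List ℕ} (h : u <+: v) {c : ℕ} (hc : c < u.length) :
    v.getD c 0 = u.getD c 0 := by
  obtain ⟨w, rfl⟩ := h
  rw [List.getD_append _ _ _ _ hc]

theorem map_range_prefix {β : Type*} {a b : ℕ} {f g : ℕ → β} (hab : a ≤ b)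
    (h : ∀ n < a, f n = g n) : (List.range a).map f <+: (List.range b).map g := by
  obtain ⟨c, rfl⟩ := Nat.exists_eq_add_of_le hab
  rw [List.range_add, List.map_append,
    List.map_congr_left (f := f) (g := g) fun n hn => h n (List.mem_range.1 hn)]
  exact List.prefix_append _ _

/-- A functional on Baire space whose `n`-th value is computable from the first `2 n + 2` entries of
the two arguments. -/
structure IsLocalFunctional (G : Baire → Baire → Baire) : Prop where
  computable : Computable fun x : (List ℕ × List ℕ) × ℕ =>
    G (fun c => x.1.1.getD c 0) (fun c => x.1.2.getD c 0) x.2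
  congr : ∀ {p p' q q' : Baire} {n : ℕ}, (∀ c < 2 * n + 2, p c = p' c) →
    (∀ c < 2 * n + 2, q c = q' c) → G p q n = G p' q' n

/-- The action of a functional on finite words. -/
def applyWord (G : Baire → Baire → Baire) (u v : List ℕ) : List ℕ :=
  (List.range (min (u.length / 2) (v.length / 2))).map
    (G (fun c => u.getD c 0) (fun c => v.getD c 0))

namespace IsLocalFunctional

variable {G : Baire → Baire → Baire}

theorem computable_applyWord (hG : IsLocalFunctional G) : Computable₂ (applyWord G) :=
  computable_map_range (α := List ℕ × List ℕ)
    (Primrec.nat_min.to_comp.comp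
      (computable_div_two (Computable.list_length.comp Computable.fst))
      (computable_div_two (Computable.list_length.comp Computable.snd)))
    hG.computable

theorem applyWord_mono (hG : IsLocalFunctional G) {u u' v v' : List ℕ} (hu : u <+: u') (hv : v <+: v') :
    applyWord G u v <+: applyWord G u' v' := by
  have h1 := hu.length_le
  have h2 := hv.length_le
  refine map_range_prefix (by omega) fun n hn => hG.congr (fun c hc => ?_) (fun c hc => ?_)
  · exact (getD_of_prefix hu (by omega)).symm
  · exact (getD_of_prefix hv (by omega)).symm

theorem applyWord_restrict (hG : IsLocalFunctional G) (p q : Baire) (k : ℕ) :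
    applyWord G (p.restrict k) (q.restrict k) = (G p q).restrict (k / 2) := by
  rw [applyWord, Baire.length_restrict, Baire.length_restrict, min_self]
  refine List.map_congr_left fun n hn => ?_
  have hn := List.mem_range.1 hn
  exact hG.congr (fun c hc => Baire.getD_restrict p (by omega))
    fun c hc => Baire.getD_restrict q (by omega)

end IsLocalFunctional

theorem Baire.restrict_prefix (p : Baire) {k l : ℕ} (h : k ≤ l) : p.restrict k <+: p.restrict l :=
  map_range_prefix h fun _ _ => rfl

theorem Baire.eq_of_restrict_prefix {q q' : Baire} {w : ℕ → List ℕ}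
    (hw : ∀ k l, k ≤ l → w k <+: w l) (h : ∀ n, ∃ k, q.restrict n <+: w k)
    (h' : ∀ n, ∃ k, q'.restrict n <+: w k) : q = q' := by
  funext n
  obtain ⟨k, hk⟩ := h (n + 1)
  obtain ⟨l, hl⟩ := h' (n + 1)
  have h1 := hk.trans (hw k (max k l) (le_max_left _ _))
  have h2 := hl.trans (hw l (max k l) (le_max_right _ _))
  rw [← q.getD_restrict n.lt_succ_self, ← q'.getD_restrict n.lt_succ_self,
    ← getD_of_prefix h1 (by simp [Baire.length_restrict]),
    ← getD_of_prefix h2 (by simp [Baire.length_restrict])]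

/-- Monotonicity makes the infinite limit of the words unique, so an arbitrary choice of it has the
required graph. -/
theorem exists_isComputableBaire {h : List ℕ → List ℕ} (hc : Computable h)
    (hm : ∀ u v, u <+: v → h u <+: h v) :
    ∃ F : Baire →. Baire, IsComputableBaire F ∧
      ∀ p q : Baire, q ∈ F p ↔ ∀ n, ∃ k, q.restrict n <+: h (p.restrict k) := by
  classical
  let F : Baire →. Baire := fun p =>
    ⟨∃ q : Baire, ∀ n, ∃ k, q.restrict n <+: h (p.restrict k), fun e => e.choose⟩
  have hF : ∀ p q : Baire, q ∈ F p ↔ ∀ n, ∃ k, q.restrict n <+: h (p.restrict k) := by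
    intro p q
    constructor
    · rintro ⟨e, rfl⟩
      exact e.choose_spec
    · intro hq
      refine ⟨⟨q, hq⟩, ?_⟩
      exact Baire.eq_of_restrict_prefix (w := fun k => h (p.restrict k))
        (fun k l hkl => hm _ _ (p.restrict_prefix hkl)) (Exists.choose_spec (⟨q, hq⟩ :
          ∃ q : Baire, ∀ n, ∃ k, q.restrict n <+: h (p.restrict k))) hq
  exact ⟨F, ⟨h, hc, hm, hF⟩, hF⟩

/-- The word function `u ↦ G (u, h (H (u, u)))` is again computable and monotone. The modulus `2 n +
2` leaves room for one interleaving of two names and one shift by a leading entry, which is all that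
the names of words and pairs need. -/
theorem IsComputableBaire.exists_comp {F : Baire →. Baire} (hF : IsComputableBaire F)
    {H G : Baire → Baire → Baire} (hH : IsLocalFunctional H) (hG : IsLocalFunctional G) :
    ∃ F' : Baire →. Baire, IsComputableBaire F' ∧ ∀ p, ∀ q ∈ F (H p p), G p q ∈ F' p := by
  obtain ⟨h, hc, hm, hF⟩ := hF
  have hm' : ∀ u v : List ℕ, u <+: v →
      applyWord G u (h (applyWord H u u)) <+: applyWord G v (h (applyWord H v v)) :=
    fun u v huv => hG.applyWord_mono huv (hm _ _ (hH.applyWord_mono huv huv))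
  obtain ⟨F', hF', hmem⟩ := exists_isComputableBaire
    (hG.computable_applyWord.comp Computable.id
      (hc.comp (hH.computable_applyWord.comp Computable.id Computable.id))) hm'
  refine ⟨F', hF', fun p q hq => (hmem _ _).2 fun n => ?_⟩
  obtain ⟨k, hk⟩ := (hF _ _).1 hq (2 * n)
  -- Applying `H` halves the length, so `2 * k` entries of `p` leave the `k` that `h` needs; the
  -- further `2 * n` entries let `G` produce `n` values.
  refine ⟨2 * k + 2 * n, ?_⟩
  have h1 : q.restrict (2 * n) <+: h (applyWord H (p.restrict (2 * k + 2 * n))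
      (p.restrict (2 * k + 2 * n))) := by
    rw [hH.applyWord_restrict]
    exact hk.trans (hm _ _ (Baire.restrict_prefix _ (by omega)))
  have h2 := hG.applyWord_restrict p q (2 * n)
  rw [Nat.mul_div_cancel_left _ two_pos] at h2
  rw [← h2]
  exact hG.applyWord_mono (p.restrict_prefix (by omega)) h1

/-- Reduction of `f'` to `f`: `H` prepares the input and `G` processes the output. `G` also sees the
original name `p`, since some constructions need the length of the given cover or its members again.
-/
theorem IsComputableOp.transfer {X Y X' Y' : Type*} {δ : Rep X} {ε : Rep Y} {δ' : Rep X'}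
    {ε' : Rep Y'} {f : MultiOp X Y} {f' : MultiOp X' Y'} (hf : IsComputableOp δ ε f)
    {H G : Baire → Baire → Baire} (hH : IsLocalFunctional H) (hG : IsLocalFunctional G)
    (h : ∀ p, ∀ x' ∈ δ' p, x' ∈ f'.dom → ∃ x ∈ δ (H p p), x ∈ f.dom ∧
      ∀ q, ∀ y ∈ ε q, y ∈ f.val x → ∃ y' ∈ ε' (G p q), y' ∈ f'.val x') :
    IsComputableOp δ' ε' f' := by
  obtain ⟨F, hF, hreal⟩ := hf
  obtain ⟨F', hF', hmem⟩ := hF.exists_comp hH hG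
  refine ⟨F', hF', fun p x' hx' hdom => ?_⟩
  obtain ⟨x, hx, hxdom, hy⟩ := h p x' hx' hdom
  obtain ⟨q, hq, y, hyq, hyf⟩ := hreal _ _ hx hxdom
  exact ⟨_, hmem p q hq, hy q y hyq hyf⟩

theorem isLocalFunctional_fst : IsLocalFunctional fun p _ => p where
  computable := computable_getD (Computable.fst.comp Computable.fst) Computable.snd
  congr hp _ := hp _ (by omega)

/-! ### Names of words, sequences and pairs -/

/-- All entries but the first. -/
def Baire.tail (p : Baire) : Baire := fun m => p (m + 1)

/-- The entries at even places. -/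
def Baire.even (p : Baire) : Baire := fun i => p (2 * i)

/-- The entries at odd places. -/
def Baire.odd (p : Baire) : Baire := fun i => p (2 * i + 1)

/-- The word named by `p` with respect to the total representation `g`. -/
def wordOf {S : Type*} (g : Baire → S) (p : Baire) : List S :=
  List.ofFn fun i : Fin (p 0) => g (p.tail.component i)

section Names

variable {S T : Type*} (g : Baire → S)

theorem mem_word_iff {p : Baire} {W : List S} :
    W ∈ Rep.word (fun p => Part.some (g p)) p ↔ W = wordOf g p :=
  ⟨fun ⟨_, h⟩ => h.symm, fun h => ⟨fun _ => trivial, h.symm⟩⟩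

theorem mem_seq_iff {p : Baire} {W : ℕ → S} :
    W ∈ Rep.seq (fun p => Part.some (g p)) p ↔ W = fun i => g (p.component i) :=
  ⟨fun ⟨_, h⟩ => h.symm, fun h => ⟨fun _ => trivial, h.symm⟩⟩

theorem mem_prod_iff {δ : Rep S} {ε : Rep T} {p : Baire} {z : S × T} :
    z ∈ δ.prod ε p ↔ z.1 ∈ δ p.even ∧ z.2 ∈ ε p.odd := by
  constructor
  · rintro ⟨⟨h, h'⟩, rfl⟩
    exact ⟨⟨h, rfl⟩, ⟨h', rfl⟩⟩
  · rintro ⟨⟨h, h1⟩, ⟨h', h2⟩⟩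
    exact ⟨⟨h, h'⟩, Prod.ext h1 h2⟩

theorem length_wordOf (p : Baire) : (wordOf g p).length = p 0 := by simp [wordOf]

theorem getElem_wordOf (p : Baire) {i : ℕ} (h : i < (wordOf g p).length) :
    (wordOf g p)[i] = g (p.tail.component i) := by simp [wordOf]

end Names

/-! ### Covers and order in terms of points -/

section Covers

variable {X ι κ : Type*}

/-- Replaces the infimum by a count at each point, the form in which the order is estimated
throughout. -/
theorem famOrder_le_iff {A : ι → Set X} {M : ℕ} :
    famOrder A ≤ M ↔ ∀ x, ∀ s : Finset ι, (∀ i ∈ s, x ∈ A i) → s.card ≤ M := by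
  constructor
  · intro h x s hs
    by_contra! hM
    have h1 : ((M + 1 : ℕ) : ℕ∞) ≤ famOrder A := by
      refine le_iInf₂ fun n hn => ?_
      by_contra! hlt
      have hlt : n < M + 1 := by exact_mod_cast hlt
      -- Since `n + 1 ≤ M + 1 ≤ s.card`, the set `s` supplies `n + 1` distinct indices.
      let e : Fin (n + 1) → ι := fun j => s.equivFin.symm ⟨j, by omega⟩
      have he : Function.Injective e := fun a b hab => by
        have := s.equivFin.symm.injective (Subtype.ext hab)
        exact Fin.ext (Fin.mk.inj_iff.1 this)
      have : x ∈ ⋂ j, A (e j) := mem_iInter.2 fun j => hs _ (Subtype.coe_prop _)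
      rw [hn e he] at this
      exact this
    have h2 : M + 1 ≤ M := by exact_mod_cast h1.trans h
    omega
  · intro h
    refine iInf₂_le M fun i hi => eq_empty_of_forall_notMem fun x hx => ?_
    have := h x (Finset.univ.map ⟨i, hi⟩) (by
      intro j hj
      obtain ⟨a, -, rfl⟩ := Finset.mem_map.1 hj
      exact mem_iInter.1 hx a)
    simp at this

/-- At most `M` of the sets `A i` contain a common point. -/
def OrderLE (A : ι → Set X) (M : ℕ) : Prop :=
  ∀ x, ∀ s : Finset ι, (∀ i ∈ s, x ∈ A i) → s.card ≤ M

/-- Choosing for each `i` with `x ∈ B i` an index in the fibre of `φ` over `i` is injective, so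
merging sets along `φ` never increases the number of sets at a point. -/
theorem OrderLE.of_map {A : ι → Set X} {B : κ → Set X} {M : ℕ} (hA : OrderLE A M) (φ : ι → κ)
    (h : ∀ x i, x ∈ B i → ∃ j, φ j = i ∧ x ∈ A j) : OrderLE B M := by
  classical
  intro x s hs
  rcases s.eq_empty_or_nonempty with rfl | ⟨a, ha⟩
  · simp
  have : Nonempty ι := ⟨(h x a (hs a ha)).choose⟩
  choose! e he hxe using fun i (hi : x ∈ B i) => h x i hi
  have hinj : Set.InjOn e s := fun a ha b hb hab => by
    rw [← he a (hs a ha), hab, he b (hs b hb)]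
  rw [← Finset.card_image_of_injOn hinj]
  refine hA x _ fun j hj => ?_
  obtain ⟨i, hi, rfl⟩ := Finset.mem_image.1 hj
  exact hxe i (hs i hi)

theorem OrderLE.mono {A B : ι → Set X} {M : ℕ} (hA : OrderLE A M) (h : ∀ i, B i ⊆ A i) :
    OrderLE B M := fun x s hs => hA x s fun i hi => h i (hs i hi)

/-- The first `k` sets of a sequence, followed by empty sets. -/
def truncate (k : ℕ) (A : ℕ → Set X) : ℕ → Set X := fun i => {x | i < k ∧ x ∈ A i}

theorem truncate_subset {k : ℕ} {A B : ℕ → Set X} (h : ∀ i < k, A i ⊆ B i) (i : ℕ) :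
    truncate k A i ⊆ truncate k B i := fun _ hx => ⟨hx.1, h i hx.1 hx.2⟩

theorem isCover_wordFam_iff {S : Type*} [SetLike S X] {W : List S} {A : ℕ → Set X}
    (hA : ∀ i (h : i < W.length), (W[i] : Set X) = A i) :
    IsCover (wordFam W) ↔ ∀ x, ∃ i < W.length, x ∈ A i := by
  rw [IsCover, iUnion_eq_univ_iff]
  refine forall_congr' fun x => ⟨fun ⟨i, hi⟩ => ⟨i, i.2, ?_⟩, fun ⟨i, h, hi⟩ => ⟨⟨i, h⟩, ?_⟩⟩
  · rw [← hA i i.2]; exact hi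
  · rw [← hA i h] at hi; exact hi

theorem famOrder_wordFam_le_iff {S : Type*} [SetLike S X] {W : List S} {A : ℕ → Set X}
    (hA : ∀ i (h : i < W.length), (W[i] : Set X) = A i) {M : ℕ} :
    famOrder (wordFam W) ≤ M ↔ OrderLE (truncate W.length A) M := by
  rw [famOrder_le_iff]
  change OrderLE (wordFam W) M ↔ _
  constructor
  · intro h
    refine h.of_map Fin.val fun x i ⟨hi, hx⟩ => ⟨⟨i, hi⟩, rfl, ?_⟩
    rw [← hA i hi] at hx; exact hx
  · intro h x s hs
    rw [← Finset.card_map Fin.valEmbedding]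
    refine h x _ fun i hi => ?_
    obtain ⟨j, hj, rfl⟩ := Finset.mem_map.1 hi
    refine ⟨j.2, ?_⟩
    have := hs j hj
    rw [Fin.valEmbedding_apply, ← hA j j.2]; exact this

end Covers

section Operations

variable {X : Type*} {S : Type*} [SetLike S X] (g : Baire → S)

theorem isCover_wordOf_iff (p : Baire) :
    IsCover (wordFam (wordOf g p)) ↔ ∀ x, ∃ i < p 0, x ∈ g (p.tail.component i) := by
  rw [isCover_wordFam_iff (A := fun i => (g (p.tail.component i) : Set X))
    fun i h => by rw [getElem_wordOf], length_wordOf]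
  rfl

theorem famOrder_wordOf_le_iff (p : Baire) (N : ℕ) :
    famOrder (wordFam (wordOf g p)) ≤ (N : ℕ∞) + 1 ↔
      OrderLE (truncate (p 0) fun i => (g (p.tail.component i) : Set X)) (N + 1) := by
  have h := famOrder_wordFam_le_iff (W := wordOf g p)
    (A := fun i => (g (p.tail.component i) : Set X)) (M := N + 1)
    fun i h => by rw [getElem_wordOf]
  have hk : truncate (wordOf g p).length (fun i => (g (p.tail.component i) : Set X)) =
      truncate (p 0) fun i => (g (p.tail.component i) : Set X) := by rw [length_wordOf]
  rw [hk] at h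
  exact_mod_cast h

variable [TopologicalSpace X] (o : Baire → Opens X)

theorem mem_finShrink_iff (p q : Baire) (N : ℕ) :
    wordOf g q ∈ (finShrink S N).val (wordOf o p) ↔ q 0 = p 0 ∧
      (∀ i < q 0, (g (q.tail.component i) : Set X) ⊆ o (p.tail.component i)) ∧
      (∀ x, ∃ i < q 0, x ∈ g (q.tail.component i)) ∧
      OrderLE (truncate (q 0) fun i => (g (q.tail.component i) : Set X)) (N + 1) := by
  rw [← isCover_wordOf_iff, ← famOrder_wordOf_le_iff]
  simp only [finShrink, mem_ofPred_eq, length_wordOf, getElem_wordOf]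
  refine and_congr_right fun h => and_congr_left fun _ => ?_
  exact ⟨fun H i hi => H i hi (h ▸ hi), fun H i hi _ => H i hi⟩

theorem mem_finRefine_iff (p q : Baire) (r : List ℕ) (N : ℕ) :
    (wordOf g q, r) ∈ (finRefine S N).val (wordOf o p) ↔ r.length = q 0 ∧
      (∀ j < q 0, r.getD j 0 < p 0 ∧
        (g (q.tail.component j) : Set X) ⊆ o (p.tail.component (r.getD j 0))) ∧
      (∀ x, ∃ i < q 0, x ∈ g (q.tail.component i)) ∧
      OrderLE (truncate (q 0) fun i => (g (q.tail.component i) : Set X)) (N + 1) := by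
  rw [← isCover_wordOf_iff, ← famOrder_wordOf_le_iff]
  simp only [finRefine, mem_ofPred_eq, length_wordOf, getElem_wordOf, exists_prop]
  refine and_congr_right fun h => and_congr_left fun _ => ?_
  refine ⟨fun H j hj => ?_, fun H j hj hr => ?_⟩
  · have := H j hj (h ▸ hj)
    rwa [← List.getD_eq_getElem _ 0] at this
  · have := H j hj
    rwa [List.getD_eq_getElem _ 0 hr] at this

theorem mem_seqShrink_iff (U W : ℕ → Opens X) (N : ℕ) :
    W ∈ (seqShrink X N).val U ↔ (∀ i, (W i : Set X) ⊆ U i) ∧ (∀ x, ∃ i, x ∈ W i) ∧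
      OrderLE (fun i => (W i : Set X)) (N + 1) := by
  simp only [seqShrink, mem_ofPred_eq, IsCover, iUnion_eq_univ_iff]
  rw [show (N : ℕ∞) + 1 = ((N + 1 : ℕ) : ℕ∞) by push_cast; rfl, famOrder_le_iff]
  rfl

theorem mem_seqRefine_iff (U W : ℕ → Opens X) (r : Baire) (N : ℕ) :
    (W, r) ∈ (seqRefine X N).val U ↔ (∀ j, (W j : Set X) ⊆ U (r j)) ∧ (∀ x, ∃ i, x ∈ W i) ∧
      OrderLE (fun i => (W i : Set X)) (N + 1) := by
  simp only [seqRefine, mem_ofPred_eq, IsCover, iUnion_eq_univ_iff]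
  rw [show (N : ℕ∞) + 1 = ((N + 1 : ℕ) : ℕ∞) by push_cast; rfl, famOrder_le_iff]
  rfl

end Operations

/-! ### Formal inclusion and formal separation of ideal balls -/

section Balls

open Filter Topology

variable {X : Type*} [MetricSpace X] {ν : ℕ → X} {f : ℕ × ℕ × ℕ → ℕ × ℕ}

/-- The radius of the `b`-th ideal ball. -/
noncomputable def idealRadius (b : ℕ) : ℝ := (posRat b.unpair.2 : ℝ)

theorem idealRadius_eq (b : ℕ) :
    idealRadius b = ((b.unpair.2.unpair.1 + 1 : ℕ) : ℝ) / ((b.unpair.2.unpair.2 + 1 : ℕ) : ℝ) := by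
  simp [idealRadius, posRat]

theorem mem_idealBall {x : X} {b : ℕ} :
    x ∈ idealBall ν b ↔ dist x (ν b.unpair.1) < idealRadius b := Iff.rfl

theorem mem_openOf {x : X} {p : Baire} :
    x ∈ openOf ν p ↔ ∃ i, 1 ≤ p i ∧ x ∈ idealBall ν (p i - 1) := by
  change x ∈ ⋃ (i : ℕ) (_ : 1 ≤ p i), idealBall ν (p i - 1) ↔ _
  simp

/-- `f` approximates the distances of the points `ν i`. -/
def Approximates (ν : ℕ → X) (f : ℕ × ℕ × ℕ → ℕ × ℕ) : Prop := ∀ i j k : ℕ,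
  |dist (ν i) (ν j) - ((f (i, j, k)).1 : ℝ) / (((f (i, j, k)).2 : ℝ) + 1)| < (1 / 2 : ℝ) ^ k

/-- The approximation of precision `2 ^ (-(n + 2))` of the distance of the centres of two balls
shows that the ball `b` lies `2 ^ (-n)` deep inside the ball `b'`. -/
def Inside (f : ℕ × ℕ × ℕ → ℕ × ℕ) (n b b' : ℕ) : Prop :=
  let A := (f (b.unpair.1, b'.unpair.1, n + 2)).1
  let B := (f (b.unpair.1, b'.unpair.1, n + 2)).2 + 1
  let s := b.unpair.2.unpair.1 + 1
  let s' := b.unpair.2.unpair.2 + 1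
  let r := b'.unpair.2.unpair.1 + 1
  let r' := b'.unpair.2.unpair.2 + 1
  A * s' * r' * 2 ^ (n + 2) + s * B * r' * 2 ^ (n + 2) + 5 * B * s' * r' ≤ r * B * s' * 2 ^ (n + 2)

/-- The approximation of precision `2 ^ (-(n + 2))` of the distance of the centres of two balls
shows that the ball `b` is disjoint from the ball `b'` shrunk by `2 ^ (-n)`. -/
def Outside (f : ℕ × ℕ × ℕ → ℕ × ℕ) (n b b' : ℕ) : Prop :=
  let A := (f (b.unpair.1, b'.unpair.1, n + 2)).1
  let B := (f (b.unpair.1, b'.unpair.1, n + 2)).2 + 1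
  let s := b.unpair.2.unpair.1 + 1
  let s' := b.unpair.2.unpair.2 + 1
  let r := b'.unpair.2.unpair.1 + 1
  let r' := b'.unpair.2.unpair.2 + 1
  s * B * r' * 2 ^ (n + 2) + r * B * s' * 2 ^ (n + 2) ≤ A * s' * r' * 2 ^ (n + 2) + 3 * B * s' * r'

/-- The approximate distance of the centres of two balls. -/
noncomputable def approxDist (f : ℕ × ℕ × ℕ → ℕ × ℕ) (n b b' : ℕ) : ℝ :=
  ((f (b.unpair.1, b'.unpair.1, n + 2)).1 : ℝ) / (((f (b.unpair.1, b'.unpair.1, n + 2)).2 : ℝ) + 1)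

/-- The definition is this inequality with denominators cleared, so that it is a comparison of
natural numbers and visibly decidable. -/
theorem inside_iff {n b b' : ℕ} : Inside f n b b' ↔
    approxDist f n b b' + idealRadius b + 5 * (1 / 2) ^ (n + 2) ≤ idealRadius b' := by
  rw [approxDist, idealRadius_eq, idealRadius_eq, Inside, ← @Nat.cast_le ℝ, one_div_pow]
  push_cast
  generalize ((f (b.unpair.1, b'.unpair.1, n + 2)).1 : ℝ) = A
  have hB : (0 : ℝ) < ((f (b.unpair.1, b'.unpair.1, n + 2)).2 : ℝ) + 1 := by positivity
  have hs : (0 : ℝ) < (b.unpair.2.unpair.2 : ℝ) + 1 := by positivity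
  have hr : (0 : ℝ) < (b'.unpair.2.unpair.2 : ℝ) + 1 := by positivity
  have he : (0 : ℝ) < 2 ^ (n + 2) := by positivity
  generalize ((f (b.unpair.1, b'.unpair.1, n + 2)).2 : ℝ) + 1 = B at *
  generalize (b.unpair.2.unpair.2 : ℝ) + 1 = s at *
  generalize (b'.unpair.2.unpair.2 : ℝ) + 1 = r at *
  generalize (2 : ℝ) ^ (n + 2) = e at *
  rw [div_add_div _ _ hB.ne' hs.ne', mul_one_div, div_add_div _ _ (by positivity) he.ne',
    div_le_div_iff₀ (by positivity) hr]
  constructor <;> intro h <;> linarith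

theorem outside_iff {n b b' : ℕ} : Outside f n b b' ↔
    idealRadius b + idealRadius b' ≤ approxDist f n b b' + 3 * (1 / 2) ^ (n + 2) := by
  rw [approxDist, idealRadius_eq, idealRadius_eq, Outside, ← @Nat.cast_le ℝ, one_div_pow]
  push_cast
  generalize ((f (b.unpair.1, b'.unpair.1, n + 2)).1 : ℝ) = A
  have hB : (0 : ℝ) < ((f (b.unpair.1, b'.unpair.1, n + 2)).2 : ℝ) + 1 := by positivity
  have hs : (0 : ℝ) < (b.unpair.2.unpair.2 : ℝ) + 1 := by positivity
  have hr : (0 : ℝ) < (b'.unpair.2.unpair.2 : ℝ) + 1 := by positivity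
  have he : (0 : ℝ) < 2 ^ (n + 2) := by positivity
  generalize ((f (b.unpair.1, b'.unpair.1, n + 2)).2 : ℝ) + 1 = B at *
  generalize (b.unpair.2.unpair.2 : ℝ) + 1 = s at *
  generalize (b'.unpair.2.unpair.2 : ℝ) + 1 = r at *
  generalize (2 : ℝ) ^ (n + 2) = e at *
  rw [div_add_div _ _ hs.ne' hr.ne', mul_one_div, div_add_div _ _ hB.ne' he.ne',
    div_le_div_iff₀ (by positivity) (by positivity)]
  constructor <;> intro h <;> linarith

theorem Approximates.abs_sub_lt (hf : Approximates ν f) (n b b' : ℕ) :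
    |dist (ν b.unpair.1) (ν b'.unpair.1) - approxDist f n b b'| < (1 / 2 : ℝ) ^ (n + 2) :=
  hf _ _ _

theorem half_pow_add_two (n : ℕ) : (1 / 2 : ℝ) ^ n = 4 * (1 / 2) ^ (n + 2) := by ring

/-- In units of `2 ^ (-(n + 2))` the depth is 4 and the approximation error is less than 1. Hence
the constant 5 = 4 + 1 here and 3 = 4 - 1 in `Outside`. -/
theorem Inside.dist_lt (hf : Approximates ν f) {n b b' : ℕ} (h : Inside f n b b') {x : X}
    (hx : x ∈ idealBall ν b) : dist x (ν b'.unpair.1) < idealRadius b' - (1 / 2) ^ n := by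
  have h1 := inside_iff.1 h
  have h2 := abs_lt.1 (hf.abs_sub_lt n b b')
  have h3 := mem_idealBall.1 hx
  have h4 := dist_triangle x (ν b.unpair.1) (ν b'.unpair.1)
  rw [half_pow_add_two]
  linarith

theorem Outside.lt_dist (hf : Approximates ν f) {n b b' : ℕ} (h : Outside f n b b') {x : X}
    (hx : x ∈ idealBall ν b) : idealRadius b' - (1 / 2) ^ n < dist x (ν b'.unpair.1) := by
  have h1 := outside_iff.1 h
  have h2 := abs_lt.1 (hf.abs_sub_lt n b b')
  have h3 := mem_idealBall.1 hx
  have h4 := dist_triangle_left (ν b.unpair.1) (ν b'.unpair.1) x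
  rw [half_pow_add_two]
  linarith

/-- The filter of ideal balls shrinking to the point `x`. -/
noncomputable def smallBalls (ν : ℕ → X) (x : X) : Filter ℕ :=
  comap (fun b => dist x (ν b.unpair.1) + idealRadius b) (𝓝 0)

theorem eventually_smallBalls (ν : ℕ → X) (x : X) {ε : ℝ} (hε : 0 < ε) :
    ∀ᶠ b in smallBalls ν x, dist x (ν b.unpair.1) + idealRadius b < ε :=
  tendsto_comap.eventually_lt_const hε

/-- Density supplies arbitrarily small ideal balls that actually contain `x`; the filter itself only
requires their centres and radii to be small. -/
theorem exists_mem_idealBall (hν : DenseRange ν) {x : X} {P : ℕ → Prop}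
    (hP : ∀ᶠ b in smallBalls ν x, P b) : ∃ b, P b ∧ x ∈ idealBall ν b := by
  obtain ⟨s, hs, hsub⟩ := hP
  obtain ⟨ε, hε, hball⟩ := Metric.mem_nhds_iff.1 hs
  obtain ⟨m, hm⟩ := exists_nat_one_div_lt (half_pos hε)
  obtain ⟨c, hc⟩ := hν.exists_dist_lt x (show (0 : ℝ) < 1 / (m + 1) by positivity)
  have hr : idealRadius (Nat.pair c (Nat.pair 0 m)) = 1 / ((m : ℝ) + 1) := by
    simp [idealRadius_eq]
  refine ⟨Nat.pair c (Nat.pair 0 m), hsub (hball ?_), ?_⟩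
  · beta_reduce
    rw [hr, Metric.mem_ball, Real.dist_0_eq_abs, abs_of_nonneg (by positivity)]
    simp only [Nat.unpair_pair]
    linarith
  · rw [mem_idealBall, hr]
    simpa using hc

theorem eventually_inside (hf : Approximates ν f) {x : X} {b' : ℕ} (hx : x ∈ idealBall ν b') :
    ∀ᶠ n in atTop, ∀ᶠ b in smallBalls ν x, Inside f n b b' := by
  have hg : 0 < idealRadius b' - dist x (ν b'.unpair.1) := sub_pos.2 (mem_idealBall.1 hx)
  have ht : Tendsto (fun n : ℕ => (1 / 2 : ℝ) ^ n) atTop (𝓝 0) :=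
    tendsto_pow_atTop_nhds_zero_of_lt_one (by norm_num) (by norm_num)
  filter_upwards [ht.eventually_lt_const (show 0 < (idealRadius b' - dist x (ν b'.unpair.1)) / 4 by
    linarith)] with n hn
  filter_upwards [eventually_smallBalls ν x (half_pos hg)] with b hb
  have h2 := abs_lt.1 (hf.abs_sub_lt n b b')
  have h4 := dist_triangle_left (ν b.unpair.1) (ν b'.unpair.1) x
  rw [half_pow_add_two] at hn
  have := pow_pos (one_half_pos (α := ℝ)) (n + 2)
  rw [inside_iff]
  linarith

/-- The shrinking by `2 ^ (-n)` leaves slack even when `x` is on the boundary of the ball, so here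
every `n` works, whereas `eventually_inside` needs `n` large. -/
theorem eventually_outside (hf : Approximates ν f) {x : X} {b' : ℕ} (hx : x ∉ idealBall ν b')
    (n : ℕ) : ∀ᶠ b in smallBalls ν x, Outside f n b b' := by
  rw [mem_idealBall, not_lt] at hx
  filter_upwards [eventually_smallBalls ν x (pow_pos (one_half_pos (α := ℝ)) (n + 2))] with b hb
  have h2 := abs_lt.1 (hf.abs_sub_lt n b b')
  have h4 := dist_triangle x (ν b.unpair.1) (ν b'.unpair.1)
  rw [outside_iff]
  linarith

/-! ### The stage-wise comparison of finitely many open sets -/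

/-- At stage `n` the ball `b` is seen to lie in the `j`-th component of `v`. -/
def Hit (f : ℕ × ℕ × ℕ → ℕ × ℕ) (v : Baire) (n b j : ℕ) : Prop :=
  ∃ c < n, c.unpair.1 = j ∧ 1 ≤ v c ∧ Inside f n b (v c - 1)

/-- At stage `n` the ball `b` is seen to be disjoint from what has been enumerated into the `i`-th
component of `v`, shrunk by `2 ^ (-n)`. -/
def Miss (f : ℕ × ℕ × ℕ → ℕ × ℕ) (v : Baire) (n b i : ℕ) : Prop :=
  ∀ c < n, c.unpair.1 = i → 1 ≤ v c → Outside f n b (v c - 1)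

open Classical in
/-- At stage `n` the ball `b` is seen to lie in at least `t` of the first `k` components of `v`,
but not yet in the `i`-th one. -/
def Swell (f : ℕ × ℕ × ℕ → ℕ × ℕ) (v : Baire) (k t n b i : ℕ) : Prop :=
  t ≤ Nat.count (Hit f v n b) k ∧ Miss f v n b i

open Classical in
/-- The enumeration of the balls `b` for which `P n b` holds at some stage `n`. -/
noncomputable def enumBalls (P : ℕ → ℕ → Prop) : Baire :=
  fun w => if P w.unpair.1 w.unpair.2 then w.unpair.2 + 1 else 0

theorem mem_openOf_enumBalls {P : ℕ → ℕ → Prop} {x : X} :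
    x ∈ openOf ν (enumBalls P) ↔ ∃ n b, P n b ∧ x ∈ idealBall ν b := by
  rw [mem_openOf]
  constructor
  · rintro ⟨w, h1, h2⟩
    by_cases hP : P w.unpair.1 w.unpair.2
    · simp only [enumBalls, hP, if_true, Nat.add_sub_cancel] at h2
      exact ⟨_, _, hP, h2⟩
    · simp [enumBalls, hP] at h1
  · rintro ⟨n, b, hP, hx⟩
    exact ⟨Nat.pair n b, by simpa [enumBalls, hP] using hx⟩

theorem mem_openOf_enumBalls_of_eventually (hν : DenseRange ν) {P : ℕ → ℕ → Prop} {x : X}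
    (h : ∀ᶠ n in atTop, ∀ᶠ b in smallBalls ν x, P n b) : x ∈ openOf ν (enumBalls P) := by
  obtain ⟨n, hn⟩ := h.exists
  obtain ⟨b, hb, hx⟩ := exists_mem_idealBall hν hn
  exact mem_openOf_enumBalls.2 ⟨n, b, hb, hx⟩

theorem Hit.mem_openOf (hf : Approximates ν f) {v : Baire} {n b j : ℕ} (h : Hit f v n b j) {x : X}
    (hx : x ∈ idealBall ν b) : x ∈ openOf ν (v.component j) := by
  obtain ⟨c, -, rfl, hv, hc⟩ := h
  refine EffDim.mem_openOf.2 ⟨c.unpair.2, ?_⟩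
  have := hc.dist_lt hf hx
  have := pow_pos (one_half_pos (α := ℝ)) n
  simp only [Baire.component, Nat.pair_unpair]
  exact ⟨hv, mem_idealBall.2 (by linarith)⟩

theorem eventually_hit (hf : Approximates ν f) {v : Baire} {j : ℕ} {x : X}
    (hx : x ∈ openOf ν (v.component j)) :
    ∀ᶠ n in atTop, ∀ᶠ b in smallBalls ν x, Hit f v n b j := by
  obtain ⟨m, hm, hx⟩ := mem_openOf.1 hx
  filter_upwards [eventually_inside hf hx, eventually_gt_atTop (Nat.pair j m)] with n hn hlt
  filter_upwards [hn] with b hb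
  exact ⟨Nat.pair j m, hlt, by simp, hm, hb⟩

/-- Only the finitely many balls enumerated before stage `n` matter, and small balls around `x` are
separated from each of them. -/
theorem eventually_miss (hf : Approximates ν f) {v : Baire} {i : ℕ} {x : X}
    (hx : x ∉ openOf ν (v.component i)) (n : ℕ) : ∀ᶠ b in smallBalls ν x, Miss f v n b i := by
  have : ∀ c ∈ Finset.range n, ∀ᶠ b in smallBalls ν x,
      c.unpair.1 = i → 1 ≤ v c → Outside f n b (v c - 1) := by
    intro c _
    by_cases h : c.unpair.1 = i ∧ 1 ≤ v c
    · refine (eventually_outside hf (fun hb => hx ?_) n).mono fun b hb _ _ => hb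
      obtain ⟨rfl, h⟩ := h
      refine mem_openOf.2 ⟨c.unpair.2, ?_⟩
      simp only [Baire.component, Nat.pair_unpair]
      exact ⟨h, hb⟩
    · exact .of_forall fun b h1 h2 => (h ⟨h1, h2⟩).elim
  filter_upwards [(Finset.eventually_all _).2 this] with b hb c hc
  exact hb c (Finset.mem_range.2 hc)

open Classical in
-- The hits need a common late stage, which exists because there are finitely many components; the
-- miss is available at every stage.
theorem eventually_swell (hf : Approximates ν f) {v : Baire} {k t i : ℕ} {x : X}
    (hx : x ∉ openOf ν (v.component i))
    (ht : t ≤ ((Finset.range k).filter fun j => x ∈ openOf ν (v.component j)).card) :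
    ∀ᶠ n in atTop, ∀ᶠ b in smallBalls ν x, Swell f v k t n b i := by
  have : ∀ j ∈ (Finset.range k).filter fun j => x ∈ openOf ν (v.component j),
      ∀ᶠ n in atTop, ∀ᶠ b in smallBalls ν x, Hit f v n b j :=
    fun j hj => eventually_hit hf (Finset.mem_filter.1 hj).2
  filter_upwards [(Finset.eventually_all _).2 this] with n hn
  filter_upwards [(Finset.eventually_all _).2 hn, eventually_miss hf hx n] with b hb hm
  refine ⟨ht.trans ?_, hm⟩
  rw [Nat.count_eq_card_filter_range]
  exact Finset.card_le_card fun j hj =>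
    Finset.mem_filter.2 ⟨(Finset.mem_filter.1 hj).1, hb j hj⟩

/-- Let `i ∈ I` have the earliest stage. If `|I| + t > k`, one of the at least `t` components hit by
its ball has an index `j ∈ I`. The witnessing ball of component `j` is already known at the later
stage `n j`, where `x` was found to lie outside that ball shrunk by `2 ^ (-n j)`. But `x` lies
deeper than `2 ^ (-n i) ≥ 2 ^ (-n j)` in it. -/
theorem card_add_le_of_swell (hf : Approximates ν f) {v : Baire} {k t : ℕ} {x : X} {I : Finset ℕ}
    (hI : I.Nonempty) (hIk : ∀ i ∈ I, i < k)
    (h : ∀ i ∈ I, ∃ n b, Swell f v k t n b i ∧ x ∈ idealBall ν b) : I.card + t ≤ k := by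
  classical
  by_contra! hlt
  choose! n b hs hx using h
  obtain ⟨i, hi, hmin⟩ := I.exists_min_image n hI
  have ht := (hs i hi).1
  rw [Nat.count_eq_card_filter_range] at ht
  -- Pigeonhole among the `k` indices, between `I` and the components hit by the ball of `i`.
  obtain ⟨j, hj⟩ := Finset.inter_nonempty_of_card_lt_card_add_card (s := Finset.range k)
    (fun i hi => Finset.mem_range.2 (hIk i hi)) (Finset.filter_subset (Hit f v (n i) (b i)) _)
    (by
      rw [Finset.card_range]
      exact hlt.trans_le (Nat.add_le_add_left (by convert ht) _))
  rw [Finset.mem_inter, Finset.mem_filter] at hj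
  obtain ⟨hjI, -, c, hc, hcj, hv, hin⟩ := hj
  have h1 := hin.dist_lt hf (hx i hi)
  have h2 := ((hs j hjI).2 c (hc.trans_le (hmin j hjI)) hcj hv).lt_dist hf (hx j hjI)
  have h3 : (1 / 2 : ℝ) ^ n j ≤ (1 / 2) ^ n i :=
    pow_le_pow_of_le_one (by norm_num) (by norm_num) (hmin j hjI)
  linarith

end Balls

/-! ### Computability of the comparison -/

section

variable {α : Type*} [Primcodable α] {f : ℕ × ℕ × ℕ → ℕ × ℕ}
  {v : α → Baire} {n b b' i k t : α → ℕ}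

theorem computablePred_inside (hf : Computable f) (hn : Computable n) (hb : Computable b)
    (hb' : Computable b') : ComputablePred fun a => Inside f (n a) (b a) (b' a) := by
  have hn2 := computable_add hn (Computable.const 2)
  have hF := hf.comp ((computable_unpair_fst hb).pair ((computable_unpair_fst hb').pair hn2))
  have he := computable_pow (Computable.const 2) hn2
  have hA := Computable.fst.comp hF
  have hB := Computable.succ.comp (Computable.snd.comp hF)
  have hs := Computable.succ.comp (computable_unpair_fst (computable_unpair_snd hb))
  have hs' := Computable.succ.comp (computable_unpair_snd (computable_unpair_snd hb))
  have hr := Computable.succ.comp (computable_unpair_fst (computable_unpair_snd hb'))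
  have hr' := Computable.succ.comp (computable_unpair_snd (computable_unpair_snd hb'))
  exact computablePred_le
    (computable_add
      (computable_add (computable_mul (computable_mul (computable_mul hA hs') hr') he)
        (computable_mul (computable_mul (computable_mul hs hB) hr') he))
      (computable_mul (computable_mul (computable_mul (Computable.const 5) hB) hs') hr'))
    (computable_mul (computable_mul (computable_mul hr hB) hs') he)

theorem computablePred_outside (hf : Computable f) (hn : Computable n) (hb : Computable b)
    (hb' : Computable b') : ComputablePred fun a => Outside f (n a) (b a) (b' a) := by
  have hn2 := computable_add hn (Computable.const 2)
  have hF := hf.comp ((computable_unpair_fst hb).pair ((computable_unpair_fst hb').pair hn2))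
  have he := computable_pow (Computable.const 2) hn2
  have hA := Computable.fst.comp hF
  have hB := Computable.succ.comp (Computable.snd.comp hF)
  have hs := Computable.succ.comp (computable_unpair_fst (computable_unpair_snd hb))
  have hs' := Computable.succ.comp (computable_unpair_snd (computable_unpair_snd hb))
  have hr := Computable.succ.comp (computable_unpair_fst (computable_unpair_snd hb'))
  have hr' := Computable.succ.comp (computable_unpair_snd (computable_unpair_snd hb'))
  exact computablePred_le
    (computable_add (computable_mul (computable_mul (computable_mul hs hB) hr') he)
      (computable_mul (computable_mul (computable_mul hr hB) hs') he))
    (computable_add (computable_mul (computable_mul (computable_mul hA hs') hr') he)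
      (computable_mul (computable_mul (computable_mul (Computable.const 3) hB) hs') hr'))

theorem computablePred_hit (hf : Computable f) (hv : Computable₂ v) (hn : Computable n)
    (hb : Computable b) (hi : Computable i) :
    ComputablePred fun a => Hit f (v a) (n a) (b a) (i a) := by
  have hv' : Computable fun x : α × ℕ => v x.1 x.2 := hv
  exact computablePred_exists_lt hn (computablePred_and
    (computablePred_eq (computable_unpair_fst Computable.snd) (hi.comp Computable.fst))
    (computablePred_and (computablePred_le (Computable.const 1) hv')
      (computablePred_inside hf (hn.comp Computable.fst) (hb.comp Computable.fst)
        (Computable.pred.comp hv'))))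

theorem computablePred_miss (hf : Computable f) (hv : Computable₂ v) (hn : Computable n)
    (hb : Computable b) (hi : Computable i) :
    ComputablePred fun a => Miss f (v a) (n a) (b a) (i a) := by
  have hv' : Computable fun x : α × ℕ => v x.1 x.2 := hv
  exact computablePred_forall_lt hn (computablePred_imp
    (computablePred_eq (computable_unpair_fst Computable.snd) (hi.comp Computable.fst))
    (computablePred_imp (computablePred_le (Computable.const 1) hv')
      (computablePred_outside hf (hn.comp Computable.fst) (hb.comp Computable.fst)
        (Computable.pred.comp hv'))))

theorem computablePred_swell (hf : Computable f) (hv : Computable₂ v) (hk : Computable k)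
    (ht : Computable t) (hn : Computable n) (hb : Computable b) (hi : Computable i) :
    ComputablePred fun a => Swell f (v a) (k a) (t a) (n a) (b a) (i a) := by
  classical
  refine computablePred_and (computablePred_le ht (computable_count hk ?_))
    (computablePred_miss hf hv hn hb hi)
  exact computablePred_hit hf
    (hv.comp (Computable.fst.comp Computable.fst) Computable.snd).to₂
    (hn.comp Computable.fst) (hb.comp Computable.fst) Computable.snd

theorem hit_congr {v v' : Baire} {n b j : ℕ} (h : ∀ c < n, v c = v' c) :
    Hit f v n b j ↔ Hit f v' n b j :=
  exists_congr fun c => and_congr_right fun hc => by rw [h c hc]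

theorem miss_congr {v v' : Baire} {n b i : ℕ} (h : ∀ c < n, v c = v' c) :
    Miss f v n b i ↔ Miss f v' n b i :=
  forall_congr' fun c => forall_congr' fun hc => by rw [h c hc]

/-- A stage `n` test reads only the entries below `n`; together with `unpair_unpair_le` this gives
the modulus of the enumerations. -/
theorem swell_congr {v v' : Baire} {k t n b i : ℕ} (h : ∀ c < n, v c = v' c) :
    Swell f v k t n b i ↔ Swell f v' k t n b i := by
  have : Hit f v n b = Hit f v' n b := funext fun j => propext (hit_congr h)
  rw [Swell, Swell, miss_congr h, this]

end

/-! ### Local functionals producing names of words and of pairs -/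

/-- The name with first entry `k` whose remainder has the components `E 0, E 1, …`. -/
def mkWord (k : ℕ) (E : ℕ → Baire) : Baire :=
  fun m => if m = 0 then k else E (m - 1).unpair.1 (m - 1).unpair.2

/-- The name with entries `a` at even and `b` at odd places. -/
def mkPair (a b : Baire) : Baire := fun m => if m = 2 * (m / 2) then a (m / 2) else b (m / 2)

theorem mkWord_zero (k : ℕ) (E : ℕ → Baire) : mkWord k E 0 = k := rfl

theorem component_tail_mkWord (k : ℕ) (E : ℕ → Baire) (i : ℕ) :
    (mkWord k E).tail.component i = E i := by
  funext m
  simp [mkWord, Baire.tail, Baire.component]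

theorem even_mkPair (a b : Baire) : (mkPair a b).even = a := by
  funext m
  simp [mkPair, Baire.even]

theorem odd_mkPair (a b : Baire) : (mkPair a b).odd = b := by
  funext m
  have h : (2 * m + 1) / 2 = m := by omega
  have h' : ¬ 2 * m + 1 = 2 * m := by omega
  simp only [mkPair, Baire.odd, h, h', if_false]

theorem isLocalFunctional_mkPair {A B : Baire → Baire → Baire} (hA : IsLocalFunctional A)
    (hB : IsLocalFunctional B) : IsLocalFunctional fun p q => mkPair (A p q) (B p q) where
  computable := by
    have hm := computable_div_two (Computable.snd (α := List ℕ × List ℕ) (β := ℕ))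
    have h1 := hA.computable.comp (Computable.fst.pair hm)
    have h2 := hB.computable.comp (Computable.fst.pair hm)
    have h3 := computablePred_eq Computable.snd (computable_mul (Computable.const 2) hm)
    exact computable_ite h3 h1 h2
  congr {p p' q q' n} hp hq := by
    have h1 := hA.congr (n := n / 2) (fun c hc => hp c (by omega)) fun c hc => hq c (by omega)
    have h2 := hB.congr (n := n / 2) (fun c hc => hp c (by omega)) fun c hc => hq c (by omega)
    simp only [mkPair, h1, h2]

theorem isLocalFunctional_mkWord {K : Baire → Baire → ℕ} {E : Baire → Baire → ℕ → Baire}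
    (hK : Computable fun x : List ℕ × List ℕ => K (fun c => x.1.getD c 0) fun c => x.2.getD c 0)
    (hE : Computable fun x : (List ℕ × List ℕ) × ℕ =>
      E (fun c => x.1.1.getD c 0) (fun c => x.1.2.getD c 0) x.2.unpair.1 x.2.unpair.2)
    (hK' : ∀ {p p' q q' : Baire}, (∀ c < 2, p c = p' c) → (∀ c < 2, q c = q' c) → K p q = K p' q')
    (hE' : ∀ {p p' q q' : Baire} (w : ℕ), (∀ c < 2 * w + 4, p c = p' c) →
      (∀ c < 2 * w + 4, q c = q' c) → E p q w.unpair.1 w.unpair.2 = E p' q' w.unpair.1 w.unpair.2) :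
    IsLocalFunctional fun p q => mkWord (K p q) (E p q) where
  computable := by
    have hm := computable_sub (Computable.snd (α := List ℕ × List ℕ) (β := ℕ)) (Computable.const 1)
    have h1 := hK.comp (Computable.fst (α := List ℕ × List ℕ) (β := ℕ))
    have h2 := hE.comp (Computable.fst.pair hm)
    have h3 := computablePred_eq (Computable.snd (α := List ℕ × List ℕ) (β := ℕ))
      (Computable.const 0)
    exact computable_ite h3 h1 h2
  congr {p p' q q' n} hp hq := by
    rcases n with _ | n
    · exact hK' (fun c hc => hp c (by omega)) fun c hc => hq c (by omega)
    · exact hE' n (fun c hc => hp c (by omega)) fun c hc => hq c (by omega)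

theorem isLocalFunctional_snd : IsLocalFunctional fun _ q => q where
  computable := computable_getD (Computable.snd.comp Computable.fst) Computable.snd
  congr _ hq := hq _ (by omega)

theorem isLocalFunctional_odd : IsLocalFunctional fun _ q => q.odd where
  computable := computable_getD (Computable.snd.comp Computable.fst)
    (Computable.succ.comp (computable_mul (Computable.const 2) Computable.snd))
  congr _ hq := hq _ (by omega)

theorem isLocalFunctional_const {s : Baire} (hs : Computable s) :
    IsLocalFunctional fun _ _ => s where
  computable := hs.comp Computable.snd
  congr _ _ := rfl

theorem computable_enumBalls {α : Type*} [Primcodable α] {P : α → ℕ → ℕ → Prop} {w : α → ℕ}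
    (hP : ComputablePred fun a => P a (w a).unpair.1 (w a).unpair.2) (hw : Computable w) :
    Computable fun a => enumBalls (P a) (w a) := by
  classical
  exact computable_ite hP (Computable.succ.comp (computable_unpair_snd hw)) (Computable.const 0)

theorem enumBalls_congr {P P' : ℕ → ℕ → Prop} {w : ℕ}
    (h : P w.unpair.1 w.unpair.2 ↔ P' w.unpair.1 w.unpair.2) : enumBalls P w = enumBalls P' w := by
  classical exact if_congr h rfl rfl

theorem unpair_unpair_le (w : ℕ) : w.unpair.2.unpair.1 ≤ w :=
  (Nat.unpair_left_le _).trans (Nat.unpair_right_le _)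

/-- The word with number `m`, read as a sequence. -/
def wordEntry (m i : ℕ) : ℕ := (Denumerable.ofNat (List ℕ) m).getD i 0

theorem computable_wordEntry {α : Type*} [Primcodable α] {m i : α → ℕ} (hm : Computable m)
    (hi : Computable i) : Computable fun a => wordEntry (m a) (i a) :=
  computable_getD ((Computable.ofNat (List ℕ)).comp hm) hi

/-! ### The functionals -/

/-- From a name `q` of a word of open sets: a name of the word of closed sets whose complements are
enumerated by comparing the components of `q` stage by stage. -/
noncomputable def closedShrinkName (f : ℕ × ℕ × ℕ → ℕ × ℕ) (_ q : Baire) : Baire :=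
  mkWord (q 0) fun i => enumBalls fun n b => Swell f q.tail (q 0) 1 n b i

/-- From a name `p` of a word of open sets and a name `q` of a word of closed sets with indices: a
name of a word of open neighbourhoods of the closed sets. -/
noncomputable def openSwellName (f : ℕ × ℕ × ℕ → ℕ × ℕ) (N : ℕ) (p q : Baire) : Baire :=
  mkWord (q 0) fun i => enumBalls fun n b =>
    Swell f q.even.tail (q 0) (q 0 - (N + 1)) n b i ∧ Hit f p.tail n b (wordEntry (q 1) i)

open Classical in
/-- From names of a word of `p 0` open sets and of a word of open sets with indices: a name of the
word of the unions of the sets with a given index. -/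
noncomputable def wordUnionName (p q : Baire) : Baire :=
  mkWord (p 0) fun i w =>
    if w.unpair.1 < q 0 ∧ wordEntry (q 1) w.unpair.1 = i then q.even.tail w else 0

/-- From names of a sequence of open sets and of a sequence of indices: a name of the sequence of
the unions of the sets with a given index. -/
def seqUnionName (_ q : Baire) : Baire :=
  fun m => if q.odd m.unpair.2.unpair.1 = m.unpair.1 then q.even m.unpair.2 else 0

/-- From a name of a word, a name of the sequence continuing it by empty sets. -/
def seqOfWordName (p : Baire) : Baire := fun m => if m.unpair.1 < p 0 then p (m + 1) else 0

theorem isLocalFunctional_closedShrinkName {f : ℕ × ℕ × ℕ → ℕ × ℕ} (hf : Computable f) :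
    IsLocalFunctional (closedShrinkName f) := by
  refine isLocalFunctional_mkWord (K := fun _ q => q 0)
    (E := fun _ q i => enumBalls fun n b => Swell f q.tail (q 0) 1 n b i)
    (computable_getD Computable.snd (Computable.const 0))
    (computable_enumBalls ?_ (computable_unpair_snd Computable.snd))
    (fun _ h => h 0 (by omega)) fun w _ h => enumBalls_congr ?_
  · have hw := computable_unpair_snd (Computable.snd (α := List ℕ × List ℕ) (β := ℕ))
    exact computablePred_swell hf
      (computable_getD (Computable.snd.comp (Computable.fst.comp Computable.fst))
        (Computable.succ.comp Computable.snd)).to₂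
      (computable_getD (Computable.snd.comp Computable.fst) (Computable.const 0))
      (Computable.const 1) (computable_unpair_fst hw) (computable_unpair_snd hw)
      (computable_unpair_fst Computable.snd)
  · have hw := unpair_unpair_le w
    rw [h 0 (by omega)]
    exact swell_congr fun c hc => h (c + 1) (by omega)

theorem isLocalFunctional_openSwellName {f : ℕ × ℕ × ℕ → ℕ × ℕ} (hf : Computable f) (N : ℕ) :
    IsLocalFunctional (openSwellName f N) := by
  refine isLocalFunctional_mkWord (K := fun _ q => q 0)
    (E := fun p q i => enumBalls fun n b =>
      Swell f q.even.tail (q 0) (q 0 - (N + 1)) n b i ∧ Hit f p.tail n b (wordEntry (q 1) i))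
    (computable_getD Computable.snd (Computable.const 0))
    (computable_enumBalls ?_ (computable_unpair_snd Computable.snd))
    (fun _ h => h 0 (by omega)) fun w hp hq => enumBalls_congr (and_congr ?_ ?_)
  · have hw := computable_unpair_snd (Computable.snd (α := List ℕ × List ℕ) (β := ℕ))
    have hk : Computable fun x : (List ℕ × List ℕ) × ℕ => x.1.2.getD 0 0 :=
      computable_getD (Computable.snd.comp Computable.fst) (Computable.const 0)
    exact computablePred_and
      (computablePred_swell hf
        (computable_getD (Computable.snd.comp (Computable.fst.comp Computable.fst))
          (computable_mul (Computable.const 2) (Computable.succ.comp Computable.snd))).to₂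
        hk (computable_sub hk (Computable.const (N + 1)))
        (computable_unpair_fst hw) (computable_unpair_snd hw)
        (computable_unpair_fst Computable.snd))
      (computablePred_hit hf
        (computable_getD (Computable.fst.comp (Computable.fst.comp Computable.fst))
          (Computable.succ.comp Computable.snd)).to₂
        (computable_unpair_fst hw) (computable_unpair_snd hw)
        (computable_wordEntry
          (computable_getD (Computable.snd.comp Computable.fst) (Computable.const 1))
          (computable_unpair_fst Computable.snd)))
  · have hw := unpair_unpair_le w
    rw [hq 0 (by omega)]
    exact swell_congr fun c hc => hq (2 * (c + 1)) (by omega)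
  · have hw := unpair_unpair_le w
    rw [hq 1 (by omega)]
    exact hit_congr fun c hc => hp (c + 1) (by omega)

theorem isLocalFunctional_wordUnionName : IsLocalFunctional wordUnionName := by
  classical
  refine isLocalFunctional_mkWord (K := fun p _ => p 0)
    (E := fun p q i w =>
      if w.unpair.1 < q 0 ∧ wordEntry (q 1) w.unpair.1 = i then q.even.tail w else 0)
    (computable_getD Computable.fst (Computable.const 0))
    (computable_ite (computablePred_and ?_ ?_) ?_ (Computable.const 0))
    (fun h _ => h 0 (by omega)) fun w hp hq => ?_
  · exact computablePred_le
      (Computable.succ.comp (computable_unpair_fst (computable_unpair_snd Computable.snd)))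
      (computable_getD (Computable.snd.comp Computable.fst) (Computable.const 0))
  · exact computablePred_eq
      (computable_wordEntry
        (computable_getD (Computable.snd.comp Computable.fst) (Computable.const 1))
        (computable_unpair_fst (computable_unpair_snd Computable.snd)))
      (computable_unpair_fst Computable.snd)
  · exact computable_getD (Computable.snd.comp Computable.fst)
      (computable_mul (Computable.const 2)
        (Computable.succ.comp (computable_unpair_snd Computable.snd)))
  · have hw := Nat.unpair_right_le w
    have h2 : ∀ v : Baire, v.even.tail w.unpair.2 = v (2 * (w.unpair.2 + 1)) := fun _ => rfl
    simp only [h2, hq 0 (by omega), hq 1 (by omega), hq (2 * (w.unpair.2 + 1)) (by omega)]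

theorem isLocalFunctional_seqUnionName : IsLocalFunctional seqUnionName where
  computable := by
    have hw := computable_unpair_snd (Computable.snd (α := List ℕ × List ℕ) (β := ℕ))
    exact computable_ite
      (computablePred_eq
        (computable_getD (Computable.snd.comp Computable.fst)
          (Computable.succ.comp (computable_mul (Computable.const 2) (computable_unpair_fst hw))))
        (computable_unpair_fst Computable.snd))
      (computable_getD (Computable.snd.comp Computable.fst)
        (computable_mul (Computable.const 2) hw))
      (Computable.const 0)
  congr {p p' q q' m} _ hq := by
    have h1 := unpair_unpair_le m
    have h2 := Nat.unpair_right_le m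
    have h3 : q.odd m.unpair.2.unpair.1 = q'.odd m.unpair.2.unpair.1 := hq _ (by omega)
    exact if_congr (by rw [h3]) (hq _ (by omega)) rfl

theorem isLocalFunctional_seqOfWordName : IsLocalFunctional fun p _ => seqOfWordName p where
  computable := computable_ite
    (computablePred_le (Computable.succ.comp (computable_unpair_fst Computable.snd))
      (computable_getD (Computable.fst.comp Computable.fst) (Computable.const 0)))
    (computable_getD (Computable.fst.comp Computable.fst) (Computable.succ.comp Computable.snd))
    (Computable.const 0)
  congr {p p' q q' m} hp _ := by
    simp only [seqOfWordName, hp 0 (by omega), hp (m + 1) (by omega)]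

theorem isLocalFunctional_mkWord_component :
    IsLocalFunctional fun p q => mkWord (p 0) q.component := by
  refine isLocalFunctional_mkWord (K := fun p _ => p 0) (E := fun _ q => q.component)
    (computable_getD Computable.fst (Computable.const 0)) ?_
    (fun h _ => h 0 (by omega)) fun w _ hq => ?_
  · exact (computable_getD (Computable.snd.comp Computable.fst) Computable.snd).of_eq fun x => by
      simp [Baire.component]
  · simp only [Baire.component, Nat.pair_unpair]
    exact hq w (by omega)

/-! ### The implications -/

section Implications

variable {X : Type*} [MetricSpace X] {ν : ℕ → X} {N : ℕ} {f : ℕ × ℕ × ℕ → ℕ × ℕ}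

/-- The closed set named by `p`. -/
def closedOf (ν : ℕ → X) (p : Baire) : Closeds X := (openOf ν p).compl

theorem mem_closedOf {x : X} {p : Baire} : x ∈ closedOf ν p ↔ x ∉ openOf ν p := Iff.rfl

theorem finShrink_closeds_of_opens (hν : DenseRange ν) (hf : Computable f)
    (happ : Approximates ν f)
    (h : IsComputableOp (repOpen ν).word (repOpen ν).word (finShrink (Opens X) N)) :
    IsComputableOp (repOpen ν).word (repClosed ν).word (finShrink (Closeds X) N) := by
  classical
  refine h.transfer isLocalFunctional_fst (isLocalFunctional_closedShrinkName hf)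
    fun p U hU hdom => ⟨U, hU, hdom, fun q W hW hval => ⟨wordOf (closedOf ν)
      (closedShrinkName f p q), (mem_word_iff (closedOf ν)).2 rfl, ?_⟩⟩
  obtain rfl := (mem_word_iff (openOf ν)).1 hU
  obtain rfl := (mem_word_iff (openOf ν)).1 hW
  obtain ⟨hk, hsub, hcov, hord⟩ := (mem_finShrink_iff _ _ _ _ _).1 hval
  have hsub' : ∀ i, (closedOf ν ((closedShrinkName f p q).tail.component i) : Set X) ⊆
      openOf ν (q.tail.component i) := by
    intro i x hx
    by_contra hxi
    refine mem_closedOf.1 hx ?_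
    rw [closedShrinkName, component_tail_mkWord]
    refine mem_openOf_enumBalls_of_eventually hν (eventually_swell happ hxi ?_)
    obtain ⟨j, hj, hxj⟩ := hcov x
    exact Finset.card_pos.2 ⟨j, Finset.mem_filter.2 ⟨Finset.mem_range.2 hj, hxj⟩⟩
  refine (mem_finShrink_iff _ _ _ _ _).2
    ⟨hk, fun i hi => (hsub' i).trans (hsub i hi), fun x => ?_, ?_⟩
  · by_contra! hx
    -- A point exists, so the cover has a member and the index set `range (q 0)` is nonempty.
    obtain ⟨j, hj, -⟩ := hcov x
    have := card_add_le_of_swell happ (v := q.tail) (k := q 0) (t := 1) (x := x)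
      (I := Finset.range (q 0)) ⟨j, Finset.mem_range.2 hj⟩ (fun i hi => Finset.mem_range.1 hi)
      fun i hi => by
        have := hx i (Finset.mem_range.1 hi)
        rw [mem_closedOf, not_not, closedShrinkName, component_tail_mkWord,
          mem_openOf_enumBalls] at this
        exact this
    rw [Finset.card_range] at this
    omega
  · exact hord.mono (truncate_subset fun i _ => hsub' i)

/-- A name `q` of a pair interleaves the two names, so `q 0` is the number of closed sets and `q 1`
the number of the index word. The components of `q.even.tail` name the complements of the closed
sets, and these are the open sets being compared. -/
theorem finRefine_opens_of_closeds (hν : DenseRange ν) (hf : Computable f)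
    (happ : Approximates ν f)
    (h : IsComputableOp (repOpen ν).word ((repClosed ν).word.prod repNatWord)
      (finRefine (Closeds X) N)) :
    IsComputableOp (repOpen ν).word ((repOpen ν).word.prod repNatWord)
      (finRefine (Opens X) N) := by
  classical
  refine h.transfer isLocalFunctional_fst
    (isLocalFunctional_mkPair (isLocalFunctional_openSwellName hf N) isLocalFunctional_odd)
    fun p U hU hdom => ⟨U, hU, hdom, ?_⟩
  rintro q ⟨W, r⟩ hW hval
  refine ⟨(wordOf (openOf ν) (openSwellName f N p q), r), ?_, ?_⟩
  · rw [mem_prod_iff, even_mkPair, odd_mkPair]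
    exact ⟨(mem_word_iff (openOf ν)).2 rfl, (mem_prod_iff.1 hW).2⟩
  obtain ⟨hW, hr⟩ := mem_prod_iff.1 hW
  obtain rfl := (mem_word_iff (openOf ν)).1 hU
  obtain rfl := (mem_word_iff (closedOf ν)).1 hW
  obtain rfl := Part.mem_some_iff.1 hr
  obtain ⟨hlen, hsub, hcov, hord⟩ := (mem_finRefine_iff _ _ _ _ _ _).1 hval
  have hmem : ∀ x i, x ∈ openOf ν ((openSwellName f N p q).tail.component i) ↔
      ∃ n b, (Swell f q.even.tail (q 0) (q 0 - (N + 1)) n b i ∧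
        Hit f p.tail n b (wordEntry (q 1) i)) ∧ x ∈ idealBall ν b := fun x i => by
    rw [openSwellName, component_tail_mkWord, mem_openOf_enumBalls]
  refine (mem_finRefine_iff _ _ _ _ _ _).2 ⟨hlen, fun j hj => ⟨(hsub j hj).1, fun x hx => ?_⟩,
    fun x => ?_, fun x s hs => ?_⟩
  · obtain ⟨n, b, ⟨-, hhit⟩, hb⟩ := (hmem x j).1 hx
    exact hhit.mem_openOf happ hb
  · obtain ⟨i, hi, hx⟩ := hcov x
    refine ⟨i, hi, ?_⟩
    rw [openSwellName, component_tail_mkWord]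
    have hcard : q 0 - (N + 1) ≤ ((Finset.range (q 0)).filter
        fun j => x ∈ openOf ν (q.even.tail.component j)).card := by
      -- The indices whose complement omits `x` are those of the closed sets containing `x`, at most
      -- `N + 1` of them.
      have h1 := hord x ((Finset.range (q 0)).filter
        fun j => ¬ x ∈ openOf ν (q.even.tail.component j)) fun j hj =>
          ⟨Finset.mem_range.1 (Finset.mem_filter.1 hj).1, (Finset.mem_filter.1 hj).2⟩
      have h2 := Finset.card_filter_add_card_filter_not (s := Finset.range (q 0))
        fun j => x ∈ openOf ν (q.even.tail.component j)
      rw [Finset.card_range] at h2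
      omega
    refine mem_openOf_enumBalls_of_eventually hν ?_
    filter_upwards [eventually_swell happ hx hcard,
      eventually_hit happ (v := p.tail) (j := wordEntry (q 1) i) ((hsub i hi).2 hx)] with n h1 h2
    exact h1.and h2
  · rcases s.eq_empty_or_nonempty with rfl | hne
    · simp
    have h1 := card_add_le_of_swell happ (v := q.even.tail) (k := q 0) (t := q 0 - (N + 1))
      (x := x) hne (fun i hi => (hs i hi).1) fun i hi => by
        obtain ⟨n, b, ⟨h, -⟩, hb⟩ := (hmem x i).1 (hs i hi).2
        exact ⟨n, b, h, hb⟩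
    -- The truncated subtraction is harmless: if `q 0 ≤ N + 1`, the threshold is 0 and `s.card ≤ q
    -- 0` suffices.
    omega

theorem finRefine_closeds_of_finShrink
    (h : IsComputableOp (repOpen ν).word (repClosed ν).word (finShrink (Closeds X) N)) :
    IsComputableOp (repOpen ν).word ((repClosed ν).word.prod repNatWord)
      (finRefine (Closeds X) N) := by
  -- The index word `0, 1, …, q 0 - 1` is the identity; only the first entry of its constant name is
  -- read.
  have hG : IsLocalFunctional fun _ q => mkPair q fun _ => Encodable.encode (List.range (q 0)) :=
    isLocalFunctional_mkPair isLocalFunctional_snd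
      { computable := Computable.encode.comp (Primrec.list_range.to_comp.comp
          (computable_getD (Computable.snd.comp Computable.fst) (Computable.const 0)))
        congr := fun _ hq => by rw [hq 0 (by omega)] }
  refine h.transfer isLocalFunctional_fst hG fun p U hU hdom => ⟨U, hU, hdom, fun q W hW hval =>
    ⟨(W, List.range (q 0)), ?_, ?_⟩⟩
  · rw [mem_prod_iff, even_mkPair, odd_mkPair]
    exact ⟨hW, Part.mem_some_iff.2 (Denumerable.ofNat_encode _).symm⟩
  obtain rfl := (mem_word_iff (openOf ν)).1 hU
  obtain rfl := (mem_word_iff (closedOf ν)).1 hW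
  obtain ⟨hk, hsub, hcov, hord⟩ := (mem_finShrink_iff _ _ _ _ _).1 hval
  refine (mem_finRefine_iff _ _ _ _ _ _).2 ⟨List.length_range, fun j hj => ?_, hcov, hord⟩
  rw [List.getD_eq_getElem _ _ (by simpa using hj), List.getElem_range]
  exact ⟨hk ▸ hj, hsub j hj⟩

/-- The bound `j < q 0` is essential: beyond its length the index word reads as 0, so unused
components of the name would otherwise be added to the set with index 0. -/
theorem mem_openOf_wordUnionName {p q : Baire} {x : X} {i : ℕ} :
    x ∈ openOf ν ((wordUnionName p q).tail.component i) ↔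
      ∃ j < q 0, wordEntry (q 1) j = i ∧ x ∈ openOf ν (q.even.tail.component j) := by
  rw [wordUnionName, component_tail_mkWord]
  simp only [mem_openOf]
  constructor
  · rintro ⟨w, h1, h2⟩
    split_ifs at h1 h2 with hw
    · exact ⟨w.unpair.1, hw.1, hw.2, w.unpair.2, by simpa [Baire.component] using ⟨h1, h2⟩⟩
    · omega
  · rintro ⟨j, hj, hji, m, h⟩
    refine ⟨Nat.pair j m, ?_⟩
    rw [Nat.unpair_pair, if_pos ⟨hj, hji⟩]
    exact h

theorem finShrink_opens_of_finRefine
    (h : IsComputableOp (repOpen ν).word ((repOpen ν).word.prod repNatWord)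
      (finRefine (Opens X) N)) :
    IsComputableOp (repOpen ν).word (repOpen ν).word (finShrink (Opens X) N) := by
  refine h.transfer isLocalFunctional_fst isLocalFunctional_wordUnionName
    fun p U hU hdom => ⟨U, hU, hdom, ?_⟩
  rintro q ⟨W, r⟩ hW hval
  refine ⟨wordOf (openOf ν) (wordUnionName p q), (mem_word_iff (openOf ν)).2 rfl, ?_⟩
  obtain ⟨hW, hr⟩ := mem_prod_iff.1 hW
  obtain rfl := (mem_word_iff (openOf ν)).1 hU
  obtain rfl := (mem_word_iff (openOf ν)).1 hW
  obtain rfl := Part.mem_some_iff.1 hr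
  obtain ⟨hlen, hsub, hcov, hord⟩ := (mem_finRefine_iff _ _ _ _ _ _).1 hval
  refine (mem_finShrink_iff _ _ _ _ _).2 ⟨rfl, fun i hi x hx => ?_, fun x => ?_, ?_⟩
  · obtain ⟨j, hj, rfl, hxj⟩ := mem_openOf_wordUnionName.1 hx
    exact (hsub j hj).2 hxj
  · obtain ⟨j, hj, hx⟩ := hcov x
    exact ⟨_, (hsub j hj).1, mem_openOf_wordUnionName.2 ⟨j, hj, rfl, hx⟩⟩
  · refine hord.of_map (wordEntry (q 1)) fun x i hx => ?_
    obtain ⟨j, hj, hji, hxj⟩ := mem_openOf_wordUnionName.1 hx.2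
    exact ⟨j, hji, hj, hxj⟩

theorem mem_openOf_seqUnionName {p q : Baire} {x : X} {i : ℕ} :
    x ∈ openOf ν ((seqUnionName p q).component i) ↔
      ∃ j, q.odd j = i ∧ x ∈ openOf ν (q.even.component j) := by
  simp only [mem_openOf, seqUnionName, Baire.component, Nat.unpair_pair]
  constructor
  · rintro ⟨w, h1, h2⟩
    split_ifs at h1 h2 with hw
    · exact ⟨w.unpair.1, hw, w.unpair.2, by simpa using ⟨h1, h2⟩⟩
    · omega
  · rintro ⟨j, hji, m, h⟩
    refine ⟨Nat.pair j m, ?_⟩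
    rw [Nat.unpair_pair, if_pos hji]
    exact h

theorem seqShrink_of_seqRefine
    (h : IsComputableOp (repOpen ν).seq ((repOpen ν).seq.prod repBaire) (seqRefine X N)) :
    IsComputableOp (repOpen ν).seq (repOpen ν).seq (seqShrink X N) := by
  refine h.transfer isLocalFunctional_fst isLocalFunctional_seqUnionName
    fun p U hU hdom => ⟨U, hU, hdom, ?_⟩
  rintro q ⟨W, r⟩ hW hval
  refine ⟨_, (mem_seq_iff (openOf ν)).2 rfl, ?_⟩
  obtain ⟨hW, hr⟩ := mem_prod_iff.1 hW
  obtain rfl := (mem_seq_iff (openOf ν)).1 hU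
  obtain rfl := (mem_seq_iff (openOf ν)).1 hW
  obtain rfl := Part.mem_some_iff.1 hr
  obtain ⟨hsub, hcov, hord⟩ := (mem_seqRefine_iff _ _ _ _).1 hval
  refine (mem_seqShrink_iff _ _ _).2 ⟨fun i x hx => ?_, fun x => ?_, ?_⟩
  · obtain ⟨j, rfl, hxj⟩ := mem_openOf_seqUnionName.1 hx
    exact hsub j hxj
  · obtain ⟨j, hx⟩ := hcov x
    exact ⟨_, mem_openOf_seqUnionName.2 ⟨j, rfl, hx⟩⟩
  · exact hord.of_map q.odd fun x i hx => mem_openOf_seqUnionName.1 hx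

theorem seqRefine_of_seqShrink
    (h : IsComputableOp (repOpen ν).seq (repOpen ν).seq (seqShrink X N)) :
    IsComputableOp (repOpen ν).seq ((repOpen ν).seq.prod repBaire) (seqRefine X N) := by
  refine h.transfer isLocalFunctional_fst
    (isLocalFunctional_mkPair isLocalFunctional_snd (isLocalFunctional_const Computable.id))
    fun p U hU hdom => ⟨U, hU, hdom, fun q W hW hval => ⟨(W, id), ?_, hval⟩⟩
  rw [mem_prod_iff, even_mkPair, odd_mkPair]
  exact ⟨hW, Part.mem_some _⟩

theorem mem_openOf_seqOfWordName {p : Baire} {x : X} {i : ℕ} :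
    x ∈ openOf ν ((seqOfWordName p).component i) ↔
      i < p 0 ∧ x ∈ openOf ν (p.tail.component i) := by
  simp only [mem_openOf, seqOfWordName, Baire.component, Nat.unpair_pair]
  by_cases hi : i < p 0
  · simp only [hi, if_true, true_and]
    rfl
  · simp [hi]

/-- A shrinking of the extended cover is empty at every index from `p 0` on, so its first `p 0`
members already cover. -/
theorem finShrink_of_seqShrink
    (h : IsComputableOp (repOpen ν).seq (repOpen ν).seq (seqShrink X N)) :
    IsComputableOp (repOpen ν).word (repOpen ν).word (finShrink (Opens X) N) := by
  refine h.transfer isLocalFunctional_seqOfWordName isLocalFunctional_mkWord_component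
    fun p U hU hdom => ⟨_, (mem_seq_iff (openOf ν)).2 rfl, ?_, fun q W hW hval =>
      ⟨_, (mem_word_iff (openOf ν)).2 rfl, ?_⟩⟩ <;>
  obtain rfl := (mem_word_iff (openOf ν)).1 hU
  · refine iUnion_eq_univ_iff.2 fun x => ?_
    obtain ⟨i, hi, hx⟩ := (isCover_wordOf_iff _ _).1 hdom x
    exact ⟨i, mem_openOf_seqOfWordName.2 ⟨hi, hx⟩⟩
  obtain rfl := (mem_seq_iff (openOf ν)).1 hW
  obtain ⟨hsub, hcov, hord⟩ := (mem_seqShrink_iff _ _ _).1 hval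
  refine (mem_finShrink_iff _ _ _ _ _).2 ⟨rfl, ?_⟩
  simp only [component_tail_mkWord, mkWord_zero]
  refine ⟨fun i hi x hx => (mem_openOf_seqOfWordName.1 (hsub i hx)).2, fun x => ?_,
    hord.mono fun i x hx => hx.2⟩
  obtain ⟨i, hx⟩ := hcov x
  exact ⟨i, (mem_openOf_seqOfWordName.1 (hsub i hx)).1, hx⟩

end Implications

end EffDim

theorem lemma6p2 {X : Type*} [MetricSpace X] (ν : ℕ → X)
    (hν : EffDim.IsComputableMetricSpace ν) (N : ℕ) :
    List.TFAE [
      EffDim.IsComputableOp (EffDim.repOpen ν).word (EffDim.repOpen ν).word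
        (EffDim.finShrink (TopologicalSpace.Opens X) N),
      EffDim.IsComputableOp (EffDim.repOpen ν).word
        ((EffDim.repOpen ν).word.prod EffDim.repNatWord)
        (EffDim.finRefine (TopologicalSpace.Opens X) N),
      EffDim.IsComputableOp (EffDim.repOpen ν).word (EffDim.repClosed ν).word
        (EffDim.finShrink (TopologicalSpace.Closeds X) N),
      EffDim.IsComputableOp (EffDim.repOpen ν).word
        ((EffDim.repClosed ν).word.prod EffDim.repNatWord)
        (EffDim.finRefine (TopologicalSpace.Closeds X) N)] ∧
    (EffDim.IsComputableOp (EffDim.repOpen ν).seq (EffDim.repOpen ν).seq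
        (EffDim.seqShrink X N) ↔
      EffDim.IsComputableOp (EffDim.repOpen ν).seq
        ((EffDim.repOpen ν).seq.prod EffDim.repBaire)
        (EffDim.seqRefine X N)) ∧
    (EffDim.IsComputableOp (EffDim.repOpen ν).seq
        ((EffDim.repOpen ν).seq.prod EffDim.repBaire)
        (EffDim.seqRefine X N) →
      EffDim.IsComputableOp (EffDim.repOpen ν).word (EffDim.repOpen ν).word
        (EffDim.finShrink (TopologicalSpace.Opens X) N)) := by
  obtain ⟨f, hf, happ⟩ := hν.dist_computable
  refine ⟨?_, ⟨EffDim.seqRefine_of_seqShrink, EffDim.seqShrink_of_seqRefine⟩,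
    fun h => EffDim.finShrink_of_seqShrink (EffDim.seqShrink_of_seqRefine h)⟩
  tfae_have 1 → 3 := EffDim.finShrink_closeds_of_opens hν.dense hf happ
  tfae_have 3 → 4 := EffDim.finRefine_closeds_of_finShrink
  tfae_have 4 → 2 := EffDim.finRefine_opens_of_closeds hν.dense hf happ
  tfae_have 2 → 1 := EffDim.finShrink_opens_of_finRefine
  tfae_finish
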